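/- Let $A,B\in\mathbb{C}^{n\times n}$ with $n\ge 1$ and $A$ Hermitian, let $\tau>0$, and let $\|\cdot\|$ denote the Euclidean norm of vectors and the matrix 2-norm. Put $T(z)=zI-A-Be^{-\tau z}$ and $R(z)=(zI-A)^{-1}$; let $\alpha(A)$ and $\alpha(T)$ be the largest real part of an eigenvalue of $A$ and of $T$ respectively, where $\lambda$ is an eigenvalue of $T$ if $T(\lambda)$ is singular. Assume $\alpha(A)<0$ and $\alpha(T)<0$. Consider the delay differential equation \[ \dot u(t)=Au(t)+Bu(t-\tau),\qquad t\ge 0, \] where a solution is understood in the Carathéodory sense: the right-hand side is integrable on bounded intervals $[0,t]$ and $u(t)=u(0)+\int_0^t (Au(s)+Bu(s-\tau))\,ds$ for $t\ge 0$. Let $\Psi$ be the fundamental solution, i.e. the matrix-valued solution with $\Psi=0$ on $[-\tau,0)$ and $\Psi(0)=I$. Let $u$ be a solution with $u(0)=u_0$ and $u=\varphi$ on $[-\tau,0)$, where $B\varphi$ is integrable on $[-\tau,0)$. Then for all $t\ge 0$ \[ \|u(t)\|\le \|\Psi(t)\|\,\|u_0\|+\sup_{0\le\nu<\tau}\|\Psi(t-\nu)\|\int_0^\tau\|B\varphi(\nu-\tau)\|\,d\nu.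 \tag{1} \] Furthermore, let $y_0>0$ and $\eta$ satisfy \[ 1<\eta y_0<\min\Big\{\frac{y_0}{\|B\|},\,e^{-\alpha(T)\tau},\,e^{-\alpha(A)\tau}\Big\} \] (with $y_0/\|B\|=\infty$ if $B=0$), and put $x_0=-\frac1\tau\log(\eta y_0)$, \[ I_0=\frac1{2\pi}\int_{-y_0}^{y_0}\|T(x_0+iy)^{-1}-R(x_0+iy)\|\,dy,\qquad C=\frac{\|B\|\eta\sqrt{(\tau y_0)^{-2}+1}}{\pi(1-\|B\|\eta)}. \] Let $k_1$ be any function with $\|\Psi(t)\|\le k_1(t)$ for all $t\ge 0$. Then for every $t\ge 0$ the right-hand side of (1) is at most \[ k_1(t)\|u_0\|+k_2(t)\int_0^\tau\|B\varphi(\nu-\tau)\|\,d\nu, \] where \[ k_2(t)=\begin{cases}\displaystyle\sup_{0\le s\le t}\|e^{As}\| & (0\le t<\tau),\\[1ex] \displaystyle\sup_{t-\tau<s<\tau}\|e^{As}\|+\sup_{\tau<s<t}\|e^{As}\|+e^{x_0\tau}(I_0+C) & (\tau\le t<2\tau),\\[1ex] \displaystyle\sup_{t-\tau<s<t}\|e^{As}\|+e^{x_0(t-\tau)}\Big(I_0+\frac{C}{(t-\tau)/\tau}\Big)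 & (t\ge 2\tau),\end{cases} \] and a supremum over the empty set (which occurs only in the middle case, at $t=\tau$) is $0$. -/

import Mathlib

open MeasureTheory Set
-- The norm of a matrix is the operator norm induced by the Euclidean norm (the matrix 2-norm).
open scoped Matrix.Norms.L2Operator

noncomputable section

namespace DDE

/-- `u` solves `u'(t) = A u(t) + B u(t - τ)` for `t ≥ 0`, with history `u = φ` on `[-τ, 0)` and
initial value `u(0) = u₀`. As the history need not be continuous, the equation is understood in the
Carathéodory sense: the right-hand side is locally integrable and `u` is its indefinite integral
(so `u` is continuous from the right at `0`, locally absolutely continuous on `[0, ∞)`, and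
satisfies the differential equation at almost every `t > 0`). -/
structure IsSolution {E : Type*} [NormedAddCommGroup E] [NormedSpace ℂ E]
    (A B : E →L[ℂ] E) (τ : ℝ) (φ : ℝ → E) (u₀ : E) (u : ℝ → E) : Prop where
  history : ∀ t ∈ Ico (-τ) 0, u t = φ t
  initial : u 0 = u₀
  integrable : ∀ t : ℝ, 0 ≤ t →
    IntervalIntegrable (fun s => A (u s) + B (u (s - τ))) volume 0 t
  integral_eq : ∀ t : ℝ, 0 ≤ t → u t = u₀ + ∫ s in (0 : ℝ)..t, (A (u s) + B (u (s - τ)))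

variable {n : ℕ}

/-- A vector-valued solution of `u'(t) = A u(t) + B u(t - τ)`, for matrices `A` and `B`. -/
def IsVectorSolution (A B : Matrix (Fin n) (Fin n) ℂ) (τ : ℝ)
    (φ : ℝ → EuclideanSpace ℂ (Fin n)) (u₀ : EuclideanSpace ℂ (Fin n))
    (u : ℝ → EuclideanSpace ℂ (Fin n)) : Prop :=
  IsSolution (Matrix.toEuclideanCLM (𝕜 := ℂ) A) (Matrix.toEuclideanCLM (𝕜 := ℂ) B) τ φ u₀ u

/-- `Ψ` is the fundamental solution: the matrix-valued solution of `Ψ'(t) = A Ψ(t) + B Ψ(t - τ)`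
that is zero on `[-τ, 0)` and the identity at `t = 0`. -/
def IsFundamentalSolution (A B : Matrix (Fin n) (Fin n) ℂ) (τ : ℝ)
    (Ψ : ℝ → Matrix (Fin n) (Fin n) ℂ) : Prop :=
  IsSolution (ContinuousLinearMap.mul ℂ (Matrix (Fin n) (Fin n) ℂ) A)
    (ContinuousLinearMap.mul ℂ (Matrix (Fin n) (Fin n) ℂ) B) τ (fun _ => 0) 1 Ψ

/-- The characteristic matrix `T(z) = z I - A - B e^{-τ z}`. -/
def charMatrix (A B : Matrix (Fin n) (Fin n) ℂ) (τ : ℝ) (z : ℂ) : Matrix (Fin n) (Fin n) ℂ :=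
  z • (1 : Matrix (Fin n) (Fin n) ℂ) - A - Complex.exp (-τ * z) • B

/-- The resolvent `R(z) = (z I - A)⁻¹`. -/
def resolventMatrix (A : Matrix (Fin n) (Fin n) ℂ) (z : ℂ) : Matrix (Fin n) (Fin n) ℂ :=
  (z • (1 : Matrix (Fin n) (Fin n) ℂ) - A)⁻¹

/-- The eigenvalues of a matrix-valued function: the points at which it is singular. -/
def eigenvalues (T : ℂ → Matrix (Fin n) (Fin n) ℂ) : Set ℂ :=
  {z | ¬ IsUnit (T z)}

/-- The largest (supremal) real part of a set of eigenvalues. -/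
def abscissa (S : Set ℂ) : ℝ :=
  sSup (Complex.re '' S)

/-- The spectral abscissa `α(A)` of a matrix. -/
def matrixAbscissa (A : Matrix (Fin n) (Fin n) ℂ) : ℝ :=
  abscissa (spectrum ℂ A)

/-- The spectral abscissa `α(T)` of the characteristic matrix function. -/
def charAbscissa (A B : Matrix (Fin n) (Fin n) ℂ) (τ : ℝ) : ℝ :=
  abscissa (eigenvalues (charMatrix A B τ))

/-- Admissible contour parameters: `y₀ > 0` and
`1 < η y₀ < min {y₀ / ‖B‖, e^{-α(T) τ}, e^{-α(A) τ}}`. The condition `η y₀ < y₀ / ‖B‖` is written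
as `η ‖B‖ < 1`, so that it is void when `B = 0` (where `y₀ / ‖B‖ = ∞`). -/
structure Admissible (A B : Matrix (Fin n) (Fin n) ℂ) (τ y₀ η : ℝ) : Prop where
  y₀_pos : 0 < y₀
  one_lt : 1 < η * y₀
  lt_norm : η * ‖B‖ < 1
  lt_char : η * y₀ < Real.exp (-charAbscissa A B τ * τ)
  lt_matrix : η * y₀ < Real.exp (-matrixAbscissa A * τ)

/-- The abscissa `x₀ = -(1/τ) log (η y₀)` of the vertical part of the contour. -/
def x₀ (τ y₀ η : ℝ) : ℝ :=
  -(1 / τ) * Real.log (η * y₀)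

/-- `I₀ = (1/2π) ∫_{-y₀}^{y₀} ‖T(x₀ + i y)⁻¹ - R(x₀ + i y)‖ dy`. -/
def I₀ (A B : Matrix (Fin n) (Fin n) ℂ) (τ y₀ η : ℝ) : ℝ :=
  1 / (2 * Real.pi) * ∫ y in (-y₀)..y₀,
    ‖(charMatrix A B τ (x₀ τ y₀ η + y * Complex.I))⁻¹
      - resolventMatrix A (x₀ τ y₀ η + y * Complex.I)‖

/-- `C = ‖B‖ η √((τ y₀)⁻² + 1) / (π (1 - ‖B‖ η))`. -/
def C (B : Matrix (Fin n) (Fin n) ℂ) (τ y₀ η : ℝ) : ℝ :=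
  ‖B‖ * η * Real.sqrt (((τ * y₀) ^ 2)⁻¹ + 1) / (Real.pi * (1 - ‖B‖ * η))

/-- `sup_{s ∈ S} ‖exp (A s)‖`, which is `0` if `S` is empty. -/
def supExp (A : Matrix (Fin n) (Fin n) ℂ) (S : Set ℝ) : ℝ :=
  sSup ((fun s : ℝ => ‖NormedSpace.exp ((s : ℂ) • A)‖) '' S)

/-- The coefficient `k₂(t)` of the explicit piecewise bound. In the first case the supremum is over
the closed interval: for `t > 0` it equals the one over `0 < s < t`, which is over the empty set
when `t = 0`. -/
def k₂ (A B : Matrix (Fin n) (Fin n) ℂ) (τ y₀ η t : ℝ) : ℝ :=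
  if t < τ then
    supExp A (Icc 0 t)
  else if t < 2 * τ then
    supExp A (Ioo (t - τ) τ) + supExp A (Ioo τ t)
      + Real.exp (x₀ τ y₀ η * τ) * (I₀ A B τ y₀ η + C B τ y₀ η)
  else
    supExp A (Ioo (t - τ) t)
      + Real.exp (x₀ τ y₀ η * (t - τ)) * (I₀ A B τ y₀ η + C B τ y₀ η / ((t - τ) / τ))

/-- `∫_0^τ ‖B φ(ν - τ)‖ dν`. -/
def historyIntegral (B : Matrix (Fin n) (Fin n) ℂ) (τ : ℝ)
    (φ : ℝ → EuclideanSpace ℂ (Fin n)) : ℝ :=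
  ∫ ν in (0 : ℝ)..τ, ‖Matrix.toEuclideanCLM (𝕜 := ℂ) B (φ (ν - τ))‖

/-- `‖Ψ(t)‖ ‖u₀‖ + sup_{0 ≤ ν < τ} ‖Ψ(t - ν)‖ ∫_0^τ ‖B φ(ν - τ)‖ dν`. -/
def historyBound (B : Matrix (Fin n) (Fin n) ℂ) (τ : ℝ) (Ψ : ℝ → Matrix (Fin n) (Fin n) ℂ)
    (φ : ℝ → EuclideanSpace ℂ (Fin n)) (u₀ : EuclideanSpace ℂ (Fin n)) (t : ℝ) : ℝ :=
  ‖Ψ t‖ * ‖u₀‖ + sSup ((fun ν : ℝ => ‖Ψ (t - ν)‖) '' Ico 0 τ) * historyIntegral B τ φ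

end DDE

end

/-! Variation of constants writes `u t` as `Ψ t` applied to `u₀` plus the convolution of `Ψ` with
the history term `B φ(ν - τ)` on `[0, τ)`; estimate (1) is its norm bound
(`IsMildSolution.eq_fundamental_add`, `norm_le_historyBound`). What remains is to bound `‖Ψ s‖` for
`t - τ < s ≤ t`.

For `0 ≤ s ≤ τ` the delay is not yet felt and `Ψ s = e^{As}`. Later, `Ψ s - e^{As}` is the inverse
Laplace transform of `T⁻¹ - R`. Subtracting the semigroup removes the jump at `0`, and `T⁻¹ - R = R
B e^{-τz} T⁻¹` decays like `|z|⁻²` on a vertical line far to the right, so the inversion integral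
converges absolutely (`fundamental_sub_causalExp_eq`).

That line is then deformed into the segment `Re z = x₀`, `|Im z| ≤ y₀`, continued by the curves `x =
-(1/τ) log (η |y|)`. No singularity is crossed: both abscissas lie to the left of `x₀`, and in the
region swept above and below the segment `‖B‖ e^{-τx} < |y|`. There, as `A` is Hermitian, `zI - A`
is bounded below by `|y|`, so the delay term cannot make `T` singular. On the curves `e^{-τx} = η
|y|`, so the integrand is dominated by a multiple of `e^{xt}/|y|`, whose integral is explicit; it
yields the term in `C`, and the segment yields `I₀` (`norm_integral_line_le`,
`norm_fundamental_sub_causalExp_le`). As `x₀ < 0`, this bound decreases in time and is evaluated at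
the left end of the window, which gives `k₂`. -/

noncomputable section

namespace DDE

/-! ### Gronwall's inequality in integral form. -/

theorem le_mul_exp_of_le_add_integral {g : ℝ → ℝ} {K M T : ℝ} (hM : 0 ≤ M)
    (hg : ContinuousOn g (Icc 0 T)) (h0 : ∀ t ∈ Icc 0 T, 0 ≤ g t)
    (h : ∀ t ∈ Icc 0 T, g t ≤ K + M * ∫ s in (0 : ℝ)..t, g s) :
    ∀ t ∈ Icc 0 T, g t ≤ K * Real.exp (M * t) := by
  intro t ht
  have hT : 0 ≤ T := ht.1.trans ht.2
  set G : ℝ → ℝ := IccExtend hT (fun s : Icc (0 : ℝ) T => g s) with hG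
  have hGc : Continuous G := (continuousOn_iff_continuous_domRestrict.1 hg).Icc_extend'
  have hGg : ∀ s ∈ Icc 0 T, G s = g s := fun s hs => IccExtend_of_mem hT _ hs
  have hint : ∀ s ∈ Icc 0 T, ∫ r in (0 : ℝ)..s, g r = ∫ r in (0 : ℝ)..s, G r := by
    intro s hs
    refine intervalIntegral.integral_congr fun r hr => (hGg r ?_).symm
    rw [uIcc_of_le hs.1] at hr
    exact ⟨hr.1, hr.2.trans hs.2⟩
  have hd : ∀ s, HasDerivAt (fun s => ∫ r in (0 : ℝ)..s, G r) (G s) s := fun s =>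
    (hGc.integral_hasStrictDerivAt 0 s).hasDerivAt
  have hpos : ∀ s ∈ Icc 0 T, 0 ≤ ∫ r in (0 : ℝ)..s, G r := by
    intro s hs
    refine intervalIntegral.integral_nonneg hs.1 fun r hr => ?_
    rw [hGg r ⟨hr.1, hr.2.trans hs.2⟩]
    exact h0 r ⟨hr.1, hr.2.trans hs.2⟩
  -- The differential Gronwall inequality is applied to the primitive of `g`, whose derivative is at
  -- most `M` times itself plus `K`.
  have hb := norm_le_gronwallBound_of_norm_deriv_right_le (f := fun s => ∫ r in (0 : ℝ)..s, G r)
    (f' := G) (δ := 0) (K := M) (ε := K) (a := 0) (b := T)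
    (fun s _ => (hd s).continuousAt.continuousWithinAt) (fun s _ => (hd s).hasDerivWithinAt)
    (by simp) (by
      intro s hs
      have hs' : s ∈ Icc 0 T := ⟨hs.1, hs.2.le⟩
      rw [Real.norm_of_nonneg (hpos s hs'), Real.norm_of_nonneg (by rw [hGg s hs']; exact h0 s hs'),
        hGg s hs', ← hint s hs', add_comm]
      exact h s hs') t ht
  have h1 := h t ht
  rw [Real.norm_of_nonneg (hpos t ht), ← hint t ht, sub_zero] at hb
  rcases eq_or_ne M 0 with rfl | hM0
  · simpa using h1
  · rw [gronwallBound_of_K_ne_0 hM0] at hb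
    have h2 := mul_le_mul_of_nonneg_left hb hM
    have h3 : M * (0 * Real.exp (M * t) + K / M * (Real.exp (M * t) - 1))
        = K * Real.exp (M * t) - K := by field_simp; ring
    linarith

/-! ### Functions vanishing on the negative half-line, and their primitives. -/

section Causal

variable {E : Type*} [NormedAddCommGroup E]

theorem intervalIntegrable_of_causal' {x : ℝ → E} (h0 : ∀ t < 0, x t = 0)
    (hx : ∀ t, 0 ≤ t → IntervalIntegrable x volume 0 t) (a b : ℝ) :
    IntervalIntegrable x volume a b := by
  have key : ∀ b, IntervalIntegrable x volume 0 b := by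
    intro b
    rcases le_total 0 b with hb | hb
    · exact hx b hb
    · refine IntervalIntegrable.symm ?_
      rw [intervalIntegrable_iff_integrableOn_Ioo_of_le hb]
      exact integrableOn_zero.congr_fun (fun t ht => (h0 t ht.2).symm) measurableSet_Ioo
  exact (key a).symm.trans (key b)

theorem intervalIntegrable_of_causal {x : ℝ → E} (h0 : ∀ t < 0, x t = 0)
    (hc : ContinuousOn x (Ici 0)) (a b : ℝ) : IntervalIntegrable x volume a b := by
  refine intervalIntegrable_of_causal' h0 (fun t ht => (hc.mono ?_).intervalIntegrable) a b
  rw [uIcc_of_le ht]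
  exact Icc_subset_Ici_self

theorem stronglyMeasurable_of_causal {x : ℝ → E} (h0 : ∀ t < 0, x t = 0)
    (hc : ContinuousOn x (Ici 0)) : StronglyMeasurable x := by
  have h1 : Continuous fun t => x (max 0 t) :=
    hc.comp_continuous (by fun_prop) fun t => mem_Ici.2 (le_max_left 0 t)
  have h2 : x = (Ici 0).indicator fun t => x (max 0 t) := by
    ext t
    rcases lt_or_ge t 0 with ht | ht
    · rw [indicator_of_notMem (by simpa using ht), h0 t ht]
    · rw [indicator_of_mem (mem_Ici.2 ht), max_eq_right ht]
  rw [h2]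
  exact h1.stronglyMeasurable.indicator measurableSet_Ici

theorem norm_causal {x : ℝ → E} (h0 : ∀ t < 0, x t = 0) : ∀ t < 0, ‖x t‖ = 0 := by
  intro t ht; simp [h0 t ht]

variable [NormedSpace ℝ E]

theorem primitive_of_nonpos {x : ℝ → E} (h0 : ∀ t < 0, x t = 0) {t : ℝ} (ht : t ≤ 0) :
    ∫ s in (0 : ℝ)..t, x s = 0 := by
  rw [intervalIntegral.integral_symm,
    intervalIntegral.integral_congr_Ioo_of_le (g := fun _ => (0 : E)) ht fun s hs => h0 s hs.2]
  simp

theorem primitive_mono {g : ℝ → ℝ} (h0 : ∀ t < 0, g t = 0) (hc : ContinuousOn g (Ici 0))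
    (hg : ∀ t, 0 ≤ g t) {r s : ℝ} (hrs : r ≤ s) :
    ∫ t in (0 : ℝ)..r, g t ≤ ∫ t in (0 : ℝ)..s, g t := by
  have h := intervalIntegral.integral_add_adjacent_intervals
    (intervalIntegrable_of_causal h0 hc 0 r) (intervalIntegrable_of_causal h0 hc r s)
  have h' := intervalIntegral.integral_nonneg (μ := volume) hrs fun t _ => hg t
  linarith

theorem norm_primitive_le {x : ℝ → E} (h0 : ∀ t < 0, x t = 0) (t : ℝ) :
    ‖∫ s in (0 : ℝ)..t, x s‖ ≤ ∫ s in (0 : ℝ)..t, ‖x s‖ := by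
  rcases le_total 0 t with ht | ht
  · exact intervalIntegral.norm_integral_le_integral_norm ht
  · rw [primitive_of_nonpos h0 ht, primitive_of_nonpos (norm_causal h0) ht, norm_zero]

end Causal

/-! ### Mild solutions: uniqueness, and the passage from Carathéodory solutions. -/

/-- Integrated form of `x' = A x + B x(· - τ) + f` on `[0, ∞)` with `x = 0` on `(-∞, 0)` and
`x(0) = x₀`. -/
structure IsMildSolution {E : Type*} [NormedAddCommGroup E] [NormedSpace ℂ E]
    (A B : E →L[ℂ] E) (τ : ℝ) (f : ℝ → E) (x₀ : E) (x : ℝ → E) : Prop where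
  causal : ∀ t < 0, x t = 0
  continuousOn : ContinuousOn x (Ici 0)
  eq : ∀ t, 0 ≤ t → x t = x₀ + A (∫ s in (0 : ℝ)..t, x s) + B (∫ s in (0 : ℝ)..(t - τ), x s)
    + ∫ s in (0 : ℝ)..t, f s

namespace IsMildSolution

variable {E : Type*} [NormedAddCommGroup E] [NormedSpace ℂ E]
  {A B : E →L[ℂ] E} {τ : ℝ} {f : ℝ → E} {x₀ : E} {x y : ℝ → E}

theorem intervalIntegrable (hx : IsMildSolution A B τ f x₀ x) (a b : ℝ) :
    IntervalIntegrable x volume a b :=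
  intervalIntegrable_of_causal hx.causal hx.continuousOn a b

theorem sub (hx : IsMildSolution A B τ f x₀ x) (hy : IsMildSolution A B τ f x₀ y) :
    IsMildSolution A B τ 0 0 (x - y) where
  causal t ht := by simp [hx.causal t ht, hy.causal t ht]
  continuousOn := hx.continuousOn.sub hy.continuousOn
  eq t ht := by
    simp only [Pi.sub_apply, Pi.zero_apply]
    rw [intervalIntegral.integral_sub (hx.intervalIntegrable _ _) (hy.intervalIntegrable _ _),
      intervalIntegral.integral_sub (hx.intervalIntegrable _ _) (hy.intervalIntegrable _ _),
      hx.eq t ht, hy.eq t ht, map_sub, map_sub]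
    simp
    abel

/-- Causality bounds the delayed primitive by the undelayed primitive of the norm, so the delay
disappears and Gronwall's inequality applies. With zero initial value this is uniqueness. -/
theorem norm_le (hτ : 0 ≤ τ) (hx : IsMildSolution A B τ 0 x₀ x) {t : ℝ} (ht : 0 ≤ t) :
    ‖x t‖ ≤ ‖x₀‖ * Real.exp ((‖A‖ + ‖B‖) * t) := by
  refine le_mul_exp_of_le_add_integral (g := fun t => ‖x t‖) (T := t) (by positivity)
    (hx.continuousOn.norm.mono Icc_subset_Ici_self) (fun _ _ => norm_nonneg _) ?_ t ⟨ht, le_rfl⟩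
  intro s hs
  have h1 : ‖A (∫ r in (0 : ℝ)..s, x r)‖ ≤ ‖A‖ * ∫ r in (0 : ℝ)..s, ‖x r‖ :=
    (A.le_opNorm _).trans (by gcongr; exact norm_primitive_le hx.causal s)
  have h2 : ‖B (∫ r in (0 : ℝ)..(s - τ), x r)‖ ≤ ‖B‖ * ∫ r in (0 : ℝ)..s, ‖x r‖ := by
    refine (B.le_opNorm _).trans ?_
    gcongr
    exact (norm_primitive_le hx.causal _).trans (primitive_mono (norm_causal hx.causal)
      hx.continuousOn.norm (fun _ => norm_nonneg _) (by linarith))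
  rw [hx.eq s hs.1]
  simp only [Pi.zero_apply, intervalIntegral.integral_zero, add_zero]
  calc _ ≤ ‖x₀‖ + ‖A (∫ r in (0 : ℝ)..s, x r)‖ + ‖B (∫ r in (0 : ℝ)..(s - τ), x r)‖ :=
        norm_add₃_le
    _ ≤ _ := by linarith

theorem unique (hτ : 0 ≤ τ) (hx : IsMildSolution A B τ f x₀ x)
    (hy : IsMildSolution A B τ f x₀ y) : x = y := by
  ext t
  rcases lt_or_ge t 0 with ht | ht
  · rw [hx.causal t ht, hy.causal t ht]
  · have := (hx.sub hy).norm_le hτ ht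
    simpa [sub_eq_zero] using this

end IsMildSolution

/-- A Carathéodory solution, cut off on `(-∞, 0)`, is a mild solution whose forcing term carries
the history. -/
theorem IsSolution.isMildSolution {E : Type*} [NormedAddCommGroup E] [NormedSpace ℂ E]
    [CompleteSpace E] {A B : E →L[ℂ] E} {τ : ℝ} {φ : ℝ → E} {u₀ : E} {u : ℝ → E} (hτ : 0 < τ)
    (hφ : IntegrableOn (fun s => B (φ s)) (Ico (-τ) 0) volume)
    (hu : IsSolution A B τ φ u₀ u) :
    IsMildSolution A B τ ((Ico 0 τ).indicator fun s => B (φ (s - τ))) u₀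
      ((Ici 0).indicator u) ∧ Integrable ((Ico 0 τ).indicator fun s => B (φ (s - τ))) := by
  set x := (Ici (0 : ℝ)).indicator u with hx
  set f := (Ico 0 τ).indicator fun s => B (φ (s - τ)) with hf
  have hfi : Integrable f := by
    rw [hf, integrable_indicator_iff measurableSet_Ico]
    have := (measurePreserving_sub_right volume τ).integrableOn_comp_preimage
      (MeasurableEquiv.subRight τ).measurableEmbedding (f := fun s => B (φ s)) (s := Ico (-τ) 0)
    have h2 := this.2 hφ
    have h3 : (fun x => x - τ) ⁻¹' Ico (-τ) 0 = Ico 0 τ := by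
      ext s; simp
    rw [h3] at h2
    exact h2
  have hpos : ∀ t, 0 ≤ t → x t = u t := fun t ht => indicator_of_mem (mem_Ici.2 ht) _
  have hneg : ∀ t < 0, x t = 0 := fun t ht => indicator_of_notMem (by simpa using ht) _
  have hcu : ContinuousOn u (Ici 0) := by
    intro t ht
    have h1 : ContinuousOn (fun t => u₀ + ∫ s in (0 : ℝ)..t, (A (u s) + B (u (s - τ))))
        (Icc 0 (t + 1)) := by
      have hi := hu.integrable (t + 1) (add_nonneg ht zero_le_one)
      have := intervalIntegral.continuousOn_primitive_interval' hi left_mem_uIcc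
      rw [uIcc_of_le (add_nonneg ht zero_le_one)] at this
      exact continuousOn_const.add this
    have h2 : ContinuousOn u (Icc 0 (t + 1)) :=
      h1.congr fun s hs => hu.integral_eq s hs.1
    refine (h2 t ⟨ht, by linarith⟩).mono_of_mem_nhdsWithin ?_
    rw [← Ici_inter_Iic]
    exact inter_mem_nhdsWithin _ (Iic_mem_nhds (by linarith))
  have hcx : ContinuousOn x (Ici 0) := hcu.congr fun t ht => hpos t ht
  have hi := intervalIntegrable_of_causal hneg hcx
  refine ⟨⟨hneg, hcx, fun t ht => ?_⟩, hfi⟩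
  have hrhs : ∀ s, 0 ≤ s → A (u s) + B (u (s - τ)) = A (x s) + B (x (s - τ)) + f s := by
    intro s hs
    rw [hpos s hs, add_assoc]
    congr 1
    -- Before time `τ` the delayed argument falls in the history, carried by `f`; from `τ` on it
    -- falls in `[0, ∞)`, and `f` vanishes.
    rcases lt_or_ge s τ with h | h
    · rw [hneg _ (by linarith), hf, indicator_of_mem (show s ∈ Ico 0 τ from ⟨hs, h⟩),
        hu.history _ ⟨by linarith, by linarith⟩]
      simp
    · rw [hpos _ (by linarith), hf, indicator_of_notMem (by simp [h]), add_zero]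
  have hiB : IntervalIntegrable (fun s => x (s - τ)) volume 0 t := by
    simpa using (hi (0 - τ) (t - τ)).comp_sub_right τ
  rw [hpos t ht, hu.integral_eq t ht, intervalIntegral.integral_congr
    (g := fun s => A (x s) + B (x (s - τ)) + f s)
    fun s hs => hrhs s (by rw [uIcc_of_le ht] at hs; exact hs.1)]
  have hAi : IntervalIntegrable (fun s => A (x s)) volume 0 t :=
    ⟨A.integrable_comp (hi 0 t).1, A.integrable_comp (hi 0 t).2⟩
  have hBi : IntervalIntegrable (fun s => B (x (s - τ))) volume 0 t :=
    ⟨B.integrable_comp hiB.1, B.integrable_comp hiB.2⟩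
  rw [intervalIntegral.integral_add (hAi.add hBi) hfi.intervalIntegrable,
    intervalIntegral.integral_add hAi hBi, A.intervalIntegral_comp_comm (hi 0 t),
    B.intervalIntegral_comp_comm hiB, intervalIntegral.integral_comp_sub_right x τ,
    ← intervalIntegral.integral_add_adjacent_intervals (hi (0 - τ) 0) (hi 0 (t - τ)),
    intervalIntegral.integral_symm 0 (0 - τ), primitive_of_nonpos hneg (by linarith : 0 - τ ≤ 0)]
  simp [add_assoc]

/-! ### Convolution with the fundamental solution, and variation of constants. -/

section Convolution

variable {E : Type*} [NormedAddCommGroup E] [NormedSpace ℂ E] {U : ℝ → E →L[ℂ] E} {f : ℝ → E}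

/-- A bound for `U` is available only up to time `t`; it suffices because `f` vanishes for negative
`ν`, so `s - ν` never exceeds `t` where the integrand is nonzero. -/
theorem norm_causal_convolution_le {K t : ℝ} (hU : ∀ s ≤ t, ‖U s‖ ≤ K)
    (hf0 : ∀ ν < 0, f ν = 0) {s : ℝ} (hs : s ≤ t) (ν : ℝ) : ‖U (s - ν) (f ν)‖ ≤ K * ‖f ν‖ := by
  rcases lt_or_ge ν 0 with hν | hν
  · simp [hf0 ν hν]
  · exact (ContinuousLinearMap.le_opNorm _ _).trans (by gcongr; exact hU _ (by linarith))

theorem integrable_causal_convolution (hUm : StronglyMeasurable U) (hf : Integrable f)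
    (hf0 : ∀ ν < 0, f ν = 0) {K t : ℝ} (hU : ∀ s ≤ t, ‖U s‖ ≤ K) :
    Integrable fun ν => U (t - ν) (f ν) := by
  refine (hf.norm.const_mul K).mono' ?_ (.of_forall fun ν =>
    norm_causal_convolution_le hU hf0 le_rfl ν)
  exact (ContinuousLinearMap.id ℂ (E →L[ℂ] E)).aestronglyMeasurable_comp₂
    (hUm.comp_measurable (measurable_id.const_sub t)).aestronglyMeasurable hf.aestronglyMeasurable

theorem integrable_prod_causal_convolution (hUm : StronglyMeasurable U) (hf : Integrable f)
    (hf0 : ∀ ν < 0, f ν = 0) {K t : ℝ} (hU : ∀ s ≤ t, ‖U s‖ ≤ K) :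
    Integrable (Function.uncurry fun s ν => U (s - ν) (f ν))
      ((volume.restrict (Ioc 0 t)).prod volume) := by
  have hb : Integrable (fun p : ℝ × ℝ => K * ‖f p.2‖) ((volume.restrict (Ioc 0 t)).prod volume) :=
    (hf.norm.comp_snd _).const_mul K
  refine hb.mono' ?_ ?_
  · exact (ContinuousLinearMap.id ℂ (E →L[ℂ] E)).aestronglyMeasurable_comp₂
      (hUm.comp_measurable measurable_sub).aestronglyMeasurable hf.aestronglyMeasurable.comp_snd
  · have h : ∀ᵐ p ∂((volume.restrict (Ioc 0 t)).prod (volume : Measure ℝ)), p.1 ∈ Ioc 0 t :=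
      Measure.quasiMeasurePreserving_fst.ae (ae_restrict_mem measurableSet_Ioc)
    filter_upwards [h] with p hp
    exact norm_causal_convolution_le hU hf0 hp.2 p.2

end Convolution

/-- The variation of constants formula. -/
theorem IsMildSolution.eq_fundamental_add {E : Type*} [NormedAddCommGroup E] [NormedSpace ℂ E]
    [CompleteSpace E] {A B : E →L[ℂ] E} {τ : ℝ} {f : ℝ → E} {x₀ : E} {x : ℝ → E}
    {U : ℝ → E →L[ℂ] E} (hτ : 0 ≤ τ)
    (hU : IsMildSolution (ContinuousLinearMap.mul ℂ (E →L[ℂ] E) A)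
      (ContinuousLinearMap.mul ℂ (E →L[ℂ] E) B) τ 0 1 U)
    (hf : Integrable f) (hf0 : ∀ ν < 0, f ν = 0) (hx : IsMildSolution A B τ f x₀ x) (t : ℝ) :
    x t = U t x₀ + ∫ ν, U (t - ν) (f ν) := by
  have hUb : ∀ t : ℝ, ∃ K : ℝ, ∀ s ≤ t, ‖U s‖ ≤ K := by
    intro t
    refine ⟨‖(1 : E →L[ℂ] E)‖ * Real.exp ((‖ContinuousLinearMap.mul ℂ (E →L[ℂ] E) A‖
      + ‖ContinuousLinearMap.mul ℂ (E →L[ℂ] E) B‖) * max t 0), fun s hs => ?_⟩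
    rcases lt_or_ge s 0 with h | h
    · rw [hU.causal s h, norm_zero]
      positivity
    · refine (hU.norm_le hτ h).trans ?_
      gcongr
      exact hs.trans (le_max_left _ _)
  have hUm : StronglyMeasurable U := stronglyMeasurable_of_causal hU.causal hU.continuousOn
  set P : ℝ → E →L[ℂ] E := fun t => ∫ s in (0 : ℝ)..t, U s with hP
  have hPc : Continuous P := intervalIntegral.continuous_primitive hU.intervalIntegrable 0
  have hP0 : ∀ t ≤ 0, P t = 0 := fun t ht => primitive_of_nonpos hU.causal ht
  have hPb : ∀ t : ℝ, ∃ K : ℝ, ∀ s ≤ t, ‖P s‖ ≤ K := by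
    intro t
    have h : ∀ s ≤ t, ‖P s‖ ≤ ∫ r in (0 : ℝ)..t, ‖U r‖ := fun s hs =>
      (norm_primitive_le hU.causal s).trans (primitive_mono (norm_causal hU.causal)
        hU.continuousOn.norm (fun _ => norm_nonneg _) hs)
    exact ⟨_, h⟩
  have hPi : ∀ t, Integrable fun ν => P (t - ν) (f ν) := by
    intro t
    obtain ⟨K, hb⟩ := hPb t
    exact integrable_causal_convolution hPc.stronglyMeasurable hf hf0 hb
  set v : ℝ → E := fun t => U t x₀ + ∫ ν, U (t - ν) (f ν) with hv
  have hvneg : ∀ t < 0, v t = 0 := by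
    intro t ht
    have : ∀ ν, U (t - ν) (f ν) = 0 := by
      intro ν
      rcases lt_or_ge ν 0 with h | h
      · simp [hf0 ν h]
      · simp [hU.causal (t - ν) (by linarith)]
    simp [hv, this, hU.causal t ht]
  have hUx : ∀ a b, IntervalIntegrable (fun s => U s x₀) volume a b := fun a b =>
    ⟨(hU.intervalIntegrable a b).1.apply_continuousLinearMap x₀,
      (hU.intervalIntegrable a b).2.apply_continuousLinearMap x₀⟩
  have hci : ∀ t, 0 ≤ t → IntervalIntegrable (fun s => ∫ ν, U (s - ν) (f ν)) volume 0 t := by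
    intro t ht
    obtain ⟨K, hb⟩ := hUb t
    rw [intervalIntegrable_iff_integrableOn_Ioc_of_le ht]
    exact (integrable_prod_causal_convolution hUm hf hf0 hb).integral_prod_left
  have hvi : ∀ a b, IntervalIntegrable v volume a b :=
    intervalIntegrable_of_causal' hvneg fun t ht => (hUx 0 t).add (hci t ht)
  -- Fubini replaces `U` by its continuous primitive `P`.
  have hPv : ∀ t, ∫ s in (0 : ℝ)..t, v s = P t x₀ + ∫ ν, P (t - ν) (f ν) := by
    intro t
    rcases lt_or_ge t 0 with ht | ht
    · rw [primitive_of_nonpos hvneg ht.le, hP0 t ht.le]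
      have : ∀ ν, P (t - ν) (f ν) = 0 := by
        intro ν
        rcases lt_or_ge ν 0 with h | h
        · simp [hf0 ν h]
        · simp [hP0 (t - ν) (by linarith)]
      simp [this]
    · rw [hv, intervalIntegral.integral_add (hUx 0 t) (hci t ht)]
      congr 1
      · exact (ContinuousLinearMap.intervalIntegral_apply (hU.intervalIntegrable 0 t) x₀).symm
      · obtain ⟨K, hb⟩ := hUb t
        rw [intervalIntegral.integral_of_le ht,
          integral_integral_swap (integrable_prod_causal_convolution hUm hf hf0 hb)]
        refine integral_congr_ae (.of_forall fun ν => ?_)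
        have hi : IntervalIntegrable (fun s => U (s - ν)) volume 0 t := by
          simpa using (hU.intervalIntegrable (0 - ν) (t - ν)).comp_sub_right ν
        simp only
        rw [← intervalIntegral.integral_of_le ht,
          ← ContinuousLinearMap.intervalIntegral_apply hi (f ν),
          intervalIntegral.integral_comp_sub_right U ν]
        rcases lt_or_ge ν 0 with h | h
        · simp [hf0 ν h]
        · rw [← intervalIntegral.integral_add_adjacent_intervals
            (hU.intervalIntegrable (0 - ν) 0) (hU.intervalIntegrable 0 (t - ν)),
            intervalIntegral.integral_symm 0 (0 - ν),
            primitive_of_nonpos hU.causal (by linarith : 0 - ν ≤ 0), neg_zero, zero_add]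
  have hveq : ∀ t, 0 ≤ t → v t = x₀ + A (∫ s in (0 : ℝ)..t, v s)
      + B (∫ s in (0 : ℝ)..(t - τ), v s) + ∫ s in (0 : ℝ)..t, f s := by
    intro t ht
    have hUt : ∀ s, 0 ≤ s → U s = 1 + A * P s + B * P (s - τ) := by
      intro s hs
      simpa using hU.eq s hs
    -- The mild equation of `U`, used pointwise under the convolution: its constant term `1`
    -- produces the forcing `∫ f`.
    have hpt : ∀ ν, U (t - ν) (f ν) = (Iic t).indicator f ν
        + (A (P (t - ν) (f ν)) + B (P (t - τ - ν) (f ν))) := by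
      intro ν
      rcases lt_or_ge ν 0 with h | h
      · rw [hf0 ν h]
        simp [indicator_apply, hf0 ν h]
      · rcases lt_or_ge t ν with h' | h'
        · rw [hU.causal _ (by linarith), hP0 _ (by linarith), hP0 _ (by linarith),
            indicator_of_notMem (by simpa using h')]
          simp
        · rw [indicator_of_mem (mem_Iic.2 h'), hUt _ (by linarith), sub_right_comm t τ ν]
          simp [add_assoc]
    have h1 : ∫ ν, (Iic t).indicator f ν = ∫ s in (0 : ℝ)..t, f s := by
      rw [intervalIntegral.integral_of_le ht, ← integral_Icc_eq_integral_Ioc,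
        ← integral_indicator measurableSet_Icc]
      congr 1
      ext ν
      by_cases h : 0 ≤ ν
      · simp [indicator_apply, h]
      · simp [indicator_apply, hf0 ν (not_le.1 h)]
    rw [hPv, hPv]
    simp only [hv]
    have hAB : Integrable fun ν => A (P (t - ν) (f ν)) + B (P (t - τ - ν) (f ν)) :=
      (A.integrable_comp (hPi t)).add (B.integrable_comp (hPi (t - τ)))
    rw [integral_congr_ae (.of_forall hpt), integral_add (hf.indicator measurableSet_Iic) hAB,
      integral_add (A.integrable_comp (hPi t)) (B.integrable_comp (hPi (t - τ))), h1,
      A.integral_comp_comm (hPi t), B.integral_comp_comm (hPi (t - τ)), hUt t ht]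
    simp only [map_add, add_apply, one_apply_eq_self,
      mul_apply_eq_comp]
    abel
  have hvm : IsMildSolution A B τ f x₀ v := by
    refine ⟨hvneg, ?_, hveq⟩
    have hc := intervalIntegral.continuous_primitive hvi 0
    have hcf := intervalIntegral.continuous_primitive (fun a b => hf.intervalIntegrable) 0
      (f := f) (μ := volume)
    -- Although `U` jumps at `0`, continuity of `v` on `[0, ∞)` can be read off from the integrated
    -- equation, whose right-hand side contains only primitives.
    have : Continuous fun t => x₀ + A (∫ s in (0 : ℝ)..t, v s)
      + B (∫ s in (0 : ℝ)..(t - τ), v s) + ∫ s in (0 : ℝ)..t, f s := by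
      have := hc.comp (continuous_sub_right τ)
      fun_prop
    exact this.continuousOn.congr hveq
  exact congrFun (hx.unique hτ hvm) t

/-! ### The Laplace transform of causal functions of exponential growth. -/

section Laplace

variable {E : Type*} [NormedAddCommGroup E] [NormedSpace ℂ E] {x : ℝ → E}

/-- The Laplace transform of a function on `ℝ` (usually vanishing on the negative half-line). -/
def laplace (x : ℝ → E) (z : ℂ) : E :=
  ∫ t : ℝ, Complex.exp (-z * t) • x t

theorem norm_cexp_neg_mul (z : ℂ) (t : ℝ) : ‖Complex.exp (-z * t)‖ = Real.exp (-z.re * t) := by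
  simp [Complex.norm_exp]

theorem integrable_laplace {K M : ℝ} (h0 : ∀ t < 0, x t = 0) (hm : StronglyMeasurable x)
    (hb : ∀ t, 0 ≤ t → ‖x t‖ ≤ K * Real.exp (M * t)) {z : ℂ} (hz : M < z.re) :
    Integrable fun t : ℝ => Complex.exp (-z * t) • x t := by
  have hi : Integrable ((Ici (0 : ℝ)).indicator fun t => K * Real.exp (-(z.re - M) * t)) := by
    rw [integrable_indicator_iff measurableSet_Ici, integrableOn_Ici_iff_integrableOn_Ioi]
    exact (exp_neg_integrableOn_Ioi 0 (sub_pos.2 hz)).const_mul K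
  refine hi.mono' ?_ (.of_forall fun t => ?_)
  · exact ((by fun_prop : Continuous fun t : ℝ => Complex.exp (-z * t)).aestronglyMeasurable).smul
      hm.aestronglyMeasurable
  · rcases lt_or_ge t 0 with ht | ht
    · simp [h0 t ht, not_le.2 ht]
    · rw [indicator_of_mem (mem_Ici.2 ht), norm_smul, norm_cexp_neg_mul]
      calc _ ≤ Real.exp (-z.re * t) * (K * Real.exp (M * t)) := by gcongr; exact hb t ht
        _ = K * (Real.exp (-z.re * t) * Real.exp (M * t)) := by ring
        _ = _ := by rw [← Real.exp_add]; ring_nf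

theorem laplace_eq_setIntegral (h0 : ∀ t < 0, x t = 0) (z : ℂ) :
    laplace x z = ∫ t in Ioi (0 : ℝ), Complex.exp (-z * t) • x t := by
  rw [laplace, ← integral_Ici_eq_integral_Ioi, ← integral_indicator measurableSet_Ici]
  congr 1
  ext t
  rcases lt_or_ge t 0 with ht | ht
  · simp [h0 t ht, indicator_apply]
  · simp [ht]

/-- Integration produces the factor `M⁻¹`; requiring `1 ≤ M` lets a function and its primitive share
one growth bound. -/
theorem norm_primitive_le_exp {K M : ℝ} (hM : 1 ≤ M) (hK : 0 ≤ K) (h0 : ∀ t < 0, x t = 0)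
    (hc : ContinuousOn x (Ici 0)) (hb : ∀ t, 0 ≤ t → ‖x t‖ ≤ K * Real.exp (M * t)) {t : ℝ}
    (ht : 0 ≤ t) : ‖∫ s in (0 : ℝ)..t, x s‖ ≤ K * Real.exp (M * t) := by
  have h1 : ∫ s in (0 : ℝ)..t, ‖x s‖ ≤ ∫ s in (0 : ℝ)..t, K * Real.exp (M * s) :=
    intervalIntegral.integral_mono_on ht (intervalIntegrable_of_causal h0 hc 0 t).norm
      ((by fun_prop : Continuous fun s => K * Real.exp (M * s)).intervalIntegrable _ _)
      fun s hs => hb s hs.1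
  have h2 : ∫ s in (0 : ℝ)..t, K * Real.exp (M * s) = K * (M⁻¹ * (Real.exp (M * t) - 1)) := by
    rw [intervalIntegral.integral_const_mul,
      intervalIntegral.integral_comp_mul_left (fun s => Real.exp s) (by linarith)]
    simp
  refine (norm_primitive_le h0 t).trans (h1.trans ?_)
  rw [h2]
  gcongr
  have h3 : M⁻¹ ≤ 1 := inv_le_one_of_one_le₀ hM
  have h4 : 1 ≤ Real.exp (M * t) := Real.one_le_exp (by positivity)
  nlinarith [mul_le_mul_of_nonneg_right h3 (sub_nonneg.2 h4)]

/-- Integration by parts on `(0, ∞)`: the boundary terms vanish because the primitive is zero at `0`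
and grows more slowly than `e^{Re z t}`. -/
theorem smul_laplace_primitive [CompleteSpace E] {K M : ℝ} (hM : 1 ≤ M) (hK : 0 ≤ K)
    (h0 : ∀ t < 0, x t = 0) (hc : ContinuousOn x (Ici 0))
    (hb : ∀ t, 0 ≤ t → ‖x t‖ ≤ K * Real.exp (M * t)) {z : ℂ} (hz : M < z.re) :
    z • laplace (fun t => ∫ s in (0 : ℝ)..t, x s) z = laplace x z := by
  set P : ℝ → E := fun t => ∫ s in (0 : ℝ)..t, x s with hP
  have hP0 : ∀ t ≤ 0, P t = 0 := fun t ht => primitive_of_nonpos h0 ht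
  have hPc : Continuous P :=
    intervalIntegral.continuous_primitive (intervalIntegrable_of_causal h0 hc) 0
  have hPb : ∀ t, 0 ≤ t → ‖P t‖ ≤ K * Real.exp (M * t) := fun t ht =>
    norm_primitive_le_exp hM hK h0 hc hb ht
  have hPi := integrable_laplace (fun t ht => hP0 t ht.le) hPc.stronglyMeasurable hPb hz
  have hxi := integrable_laplace h0 (stronglyMeasurable_of_causal h0 hc) hb hz
  have hd : ∀ t ∈ Ioi (0 : ℝ), HasDerivAt (fun t : ℝ => Complex.exp (-z * t) • P t)
      (Complex.exp (-z * t) • x t - z • (Complex.exp (-z * t) • P t)) t := by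
    intro t ht
    have h1 : HasDerivAt P (x t) t :=
      intervalIntegral.integral_hasDerivAt_right (intervalIntegrable_of_causal h0 hc 0 t)
        (stronglyMeasurable_of_causal h0 hc).stronglyMeasurableAtFilter
        (hc.continuousAt (Ici_mem_nhds ht))
    have h2 : HasDerivAt (fun t : ℝ => Complex.exp (-z * t)) (Complex.exp (-z * t) * (-z)) t := by
      have := ((hasDerivAt_id (t : ℂ)).const_mul (-z)).cexp.comp_ofReal
      simpa using this
    have h3 : HasDerivAt (fun t : ℝ => Complex.exp (-z * t) • P t)
        (Complex.exp (-z * t) • x t + (Complex.exp (-z * t) * -z) • P t) t := h2.smul h1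
    convert h3 using 1
    rw [mul_smul, neg_smul, smul_neg, smul_comm z, ← sub_eq_add_neg]
  have htend : Filter.Tendsto (fun t : ℝ => Complex.exp (-z * t) • P t) Filter.atTop (nhds 0) := by
    rw [tendsto_zero_iff_norm_tendsto_zero]
    have h1 : Filter.Tendsto (fun t => K * Real.exp (-((z.re - M) * t))) Filter.atTop (nhds 0) := by
      have := (Real.tendsto_exp_neg_atTop_nhds_zero.comp
        (Filter.tendsto_id.const_mul_atTop (sub_pos.2 hz))).const_mul K
      simpa using this
    refine squeeze_zero' (.of_forall fun t => norm_nonneg _) ?_ h1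
    filter_upwards [Filter.eventually_ge_atTop 0] with t ht
    rw [norm_smul, norm_cexp_neg_mul]
    calc _ ≤ Real.exp (-z.re * t) * (K * Real.exp (M * t)) := by gcongr; exact hPb t ht
      _ = K * (Real.exp (-z.re * t) * Real.exp (M * t)) := by ring
      _ = _ := by rw [← Real.exp_add]; ring_nf
  have hzPi : Integrable fun t : ℝ => z • (Complex.exp (-z * t) • P t) := hPi.smul z
  have key := integral_Ioi_of_hasDerivAt_of_tendsto (a := (0 : ℝ))
    (by fun_prop : Continuous fun t : ℝ => Complex.exp (-z * t) • P t).continuousWithinAt hd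
    (hxi.integrableOn.sub hzPi.integrableOn) htend
  rw [integral_sub hxi.integrableOn hzPi.integrableOn, integral_smul,
    ← laplace_eq_setIntegral h0, ← laplace_eq_setIntegral fun t ht => hP0 t ht.le,
    hP0 0 le_rfl, smul_zero, sub_zero, sub_eq_zero] at key
  exact key.symm

theorem laplace_comp_sub (x : ℝ → E) (τ : ℝ) (z : ℂ) :
    laplace (fun t => x (t - τ)) z = Complex.exp (-z * τ) • laplace x z := by
  have h := integral_sub_right_eq_self (μ := (volume : Measure ℝ))
    (fun t : ℝ => Complex.exp (-z * ((t + τ : ℝ) : ℂ)) • x t) τ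
  rw [laplace, laplace, ← integral_smul]
  simp only [sub_add_cancel] at h
  rw [h]
  congr 1
  ext t
  rw [smul_smul, ← Complex.exp_add]
  push_cast
  ring_nf

end Laplace

/-! ### The transform of the fundamental solution inverts the characteristic function. -/

section BanachAlgebra

variable {𝔸 : Type*} [NormedRing 𝔸] [NormedAlgebra ℂ 𝔸] {a b : 𝔸} {τ : ℝ}
  {U : ℝ → 𝔸}

/-- The mild fundamental solution in a Banach algebra. -/
abbrev IsMildFundamental (a b : 𝔸) (τ : ℝ) (U : ℝ → 𝔸) : Prop :=
  IsMildSolution (ContinuousLinearMap.mul ℂ 𝔸 a) (ContinuousLinearMap.mul ℂ 𝔸 b) τ 0 1 U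

theorem IsMildFundamental.norm_le (hτ : 0 ≤ τ) (hU : IsMildFundamental a b τ U) {M : ℝ}
    (hM : ‖a‖ + ‖b‖ ≤ M) (t : ℝ) (ht : 0 ≤ t) : ‖U t‖ ≤ ‖(1 : 𝔸)‖ * Real.exp (M * t) := by
  refine (IsMildSolution.norm_le hτ hU ht).trans ?_
  gcongr
  exact (add_le_add (ContinuousLinearMap.opNorm_mul_apply_le ℂ 𝔸 a)
    (ContinuousLinearMap.opNorm_mul_apply_le ℂ 𝔸 b)).trans hM

theorem IsMildFundamental.stronglyMeasurable (hU : IsMildFundamental a b τ U) :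
    StronglyMeasurable U :=
  stronglyMeasurable_of_causal hU.causal hU.continuousOn

/-- The integrated equation transforms to `L U = z⁻¹ + (a + e^{-zτ} b) L P`, with `P` the primitive
of `U`; multiplying by `z` and using `z L P = L U` gives the identity. Only a right inverse is
obtained, which suffices for square matrices. -/
theorem IsMildFundamental.mul_laplace [CompleteSpace 𝔸] (hτ : 0 ≤ τ) (hU : IsMildFundamental a b τ U) {z : ℂ}
    (hz : ‖a‖ + ‖b‖ + 1 < z.re) :
    (z • (1 : 𝔸) - a - Complex.exp (-τ * z) • b) * laplace U z = 1 := by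
  set M := ‖a‖ + ‖b‖ + 1 with hM
  have hM1 : 1 ≤ M := by have := norm_nonneg a; have := norm_nonneg b; linarith
  have hb := hU.norm_le hτ (M := M) (by linarith)
  have hz0 : z ≠ 0 := by
    rintro rfl
    simp only [Complex.zero_re] at hz
    linarith
  set P : ℝ → 𝔸 := fun t => ∫ s in (0 : ℝ)..t, U s with hP
  have hP0 : ∀ t ≤ 0, P t = 0 := fun t ht => primitive_of_nonpos hU.causal ht
  have hPc : Continuous P := intervalIntegral.continuous_primitive hU.intervalIntegrable 0
  have hPb : ∀ t, 0 ≤ t → ‖P t‖ ≤ ‖(1 : 𝔸)‖ * Real.exp (M * t) := fun t ht =>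
    norm_primitive_le_exp hM1 (norm_nonneg _) hU.causal hU.continuousOn hb ht
  have hPi := integrable_laplace (fun t ht => hP0 t ht.le) hPc.stronglyMeasurable hPb hz
  have hPτi : Integrable fun t : ℝ => Complex.exp (-z * t) • P (t - τ) := by
    have h := (hPi.comp_sub_right τ).smul (Complex.exp (-z * τ))
    refine h.congr (.of_forall fun t => ?_)
    simp only [Pi.smul_apply, smul_smul]
    rw [← Complex.exp_add]
    push_cast
    ring_nf
  have hL : z • laplace P z = laplace U z :=
    smul_laplace_primitive hM1 (norm_nonneg _) hU.causal hU.continuousOn hb hz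
  have hUt : ∀ t : ℝ, Complex.exp (-z * t) • U t =
      (Ici (0 : ℝ)).indicator (fun t : ℝ => Complex.exp (-z * t) • (1 : 𝔸)) t
        + (ContinuousLinearMap.mul ℂ 𝔸 a (Complex.exp (-z * t) • P t)
          + ContinuousLinearMap.mul ℂ 𝔸 b (Complex.exp (-z * t) • P (t - τ))) := by
    intro t
    rcases lt_or_ge t 0 with ht | ht
    · rw [hU.causal t ht, hP0 t ht.le, hP0 (t - τ) (by linarith),
        indicator_of_notMem (by simpa using ht)]
      simp
    · rw [hU.eq t ht, indicator_of_mem (mem_Ici.2 ht)]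
      simp [smul_add, add_assoc]
      rfl
  have h1i : Integrable ((Ici (0 : ℝ)).indicator fun t : ℝ => Complex.exp (-z * t) • (1 : 𝔸)) := by
    rw [integrable_indicator_iff measurableSet_Ici, integrableOn_Ici_iff_integrableOn_Ioi]
    exact (integrableOn_exp_mul_complex_Ioi (by simp; linarith) 0).smul_const _
  have h1 : ∫ t : ℝ, (Ici (0 : ℝ)).indicator (fun t : ℝ => Complex.exp (-z * t) • (1 : 𝔸)) t
      = z⁻¹ • 1 := by
    rw [integral_indicator measurableSet_Ici, integral_Ici_eq_integral_Ioi, integral_smul_const,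
      integral_exp_mul_complex_Ioi (by simp; linarith)]
    simp
  have hai := (ContinuousLinearMap.mul ℂ 𝔸 a).integrable_comp hPi
  have hbi := (ContinuousLinearMap.mul ℂ 𝔸 b).integrable_comp hPτi
  have habi : Integrable fun t : ℝ => ContinuousLinearMap.mul ℂ 𝔸 a (Complex.exp (-z * t) • P t)
      + ContinuousLinearMap.mul ℂ 𝔸 b (Complex.exp (-z * t) • P (t - τ)) := hai.add hbi
  have key : laplace U z = z⁻¹ • 1 + (a * laplace P z + b * (Complex.exp (-z * τ) • laplace P z)) := by
    rw [← laplace_comp_sub, laplace, integral_congr_ae (.of_forall hUt),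
      integral_add h1i habi, h1, integral_add hai hbi,
      ContinuousLinearMap.integral_comp_comm _ hPi, ContinuousLinearMap.integral_comp_comm _ hPτi]
    rfl
  have key2 := congrArg (fun w => z • w) key
  simp only [smul_add, smul_smul, mul_inv_cancel₀ hz0, one_smul] at key2
  rw [← mul_smul_comm, hL, ← mul_smul_comm, smul_comm z (Complex.exp _), hL] at key2
  rw [sub_mul, sub_mul, smul_mul_assoc, one_mul, key2, smul_mul_assoc, mul_smul_comm,
    show -z * (τ : ℂ) = -τ * z by ring]
  abel

end BanachAlgebra

/-! ### Inversion on a vertical line, as Fourier inversion of `e^{-ct} W(t)`. -/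

theorem laplace_inversion {E : Type*} [NormedAddCommGroup E] [NormedSpace ℂ E] [CompleteSpace E]
    {W : ℝ → E} {G : ℝ → E} {c : ℝ} (hW : Continuous W)
    (hi : Integrable fun t : ℝ => Complex.exp (-(c : ℂ) * t) • W t)
    (hG : ∀ y : ℝ, laplace W (c + y * Complex.I) = G y) (hGi : Integrable G) (t : ℝ) :
    W t = (1 / (2 * Real.pi)) • ∫ y : ℝ, Complex.exp ((c + y * Complex.I) * t) • G y := by
  set h : ℝ → E := fun t : ℝ => Complex.exp (-(c : ℂ) * t) • W t with hh
  have hhc : Continuous h := by fun_prop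
  have hF : FourierTransform.fourier h = fun w : ℝ => G (2 * Real.pi * w) := by
    ext w
    rw [Real.fourier_eq', ← hG, laplace]
    congr 1
    ext t
    simp only [hh, smul_smul]
    rw [← Complex.exp_add]
    congr 2
    simp
    ring
  have hFi : Integrable (FourierTransform.fourier h) := by
    rw [hF]
    exact hGi.comp_mul_left' (by positivity)
  have inv := congrFun (hhc.fourierInv_fourier_eq hi hFi) t
  rw [hF, Real.fourierInv_eq'] at inv
  have h2 := Measure.integral_comp_mul_left
    (fun y : ℝ => Complex.exp ((y * t : ℝ) * Complex.I) • G y) (2 * Real.pi)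
  have h3 : W t = Complex.exp ((c : ℂ) * t) • h t := by
    simp only [hh, smul_smul]
    rw [← Complex.exp_add]
    simp
  rw [h3, ← inv]
  have h4 : ∫ v : ℝ, Complex.exp (((2 * Real.pi * inner ℝ v t : ℝ) : ℂ) * Complex.I)
      • G (2 * Real.pi * v) = (1 / (2 * Real.pi)) •
        ∫ y : ℝ, Complex.exp ((y * t : ℝ) * Complex.I) • G y := by
    rw [one_div, ← abs_of_pos (show 0 < (2 * Real.pi)⁻¹ by positivity), ← h2]
    congr 1
    ext v
    congr 4
    simp
    ring
  rw [h4, smul_comm, ← integral_smul]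
  congr 2
  ext y
  rw [smul_smul, ← Complex.exp_add]
  congr 2
  push_cast
  ring

/-! ### The semigroup generated by `a`, and its agreement with the fundamental solution up to `τ`.
-/

section Semigroup

variable {𝔸 : Type*} [NormedRing 𝔸] [NormedAlgebra ℂ 𝔸] {a b : 𝔸} {τ : ℝ}
  {U : ℝ → 𝔸}

/-- The semigroup `t ↦ exp (t a)`, cut off on `(-∞, 0)`. -/
def causalExp (a : 𝔸) : ℝ → 𝔸 :=
  (Ici (0 : ℝ)).indicator fun t => NormedSpace.exp ((t : ℂ) • a)

theorem causalExp_of_nonneg (a : 𝔸) {t : ℝ} (ht : 0 ≤ t) :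
    causalExp a t = NormedSpace.exp ((t : ℂ) • a) :=
  indicator_of_mem (mem_Ici.2 ht) _

variable [CompleteSpace 𝔸]

theorem hasDerivAt_exp_ofReal_smul (a : 𝔸) (t : ℝ) :
    HasDerivAt (fun s : ℝ => NormedSpace.exp ((s : ℂ) • a))
      (a * NormedSpace.exp ((t : ℂ) • a)) t := by
  have h := (hasDerivAt_exp_smul_const' a (t : ℂ)).scomp t Complex.ofRealCLM.hasDerivAt
  rw [Complex.ofRealCLM_apply, Complex.ofReal_one, one_smul] at h
  exact h

theorem continuous_exp_ofReal_smul (a : 𝔸) :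
    Continuous fun s : ℝ => NormedSpace.exp ((s : ℂ) • a) :=
  continuous_iff_continuousAt.2 fun t => (hasDerivAt_exp_ofReal_smul a t).continuousAt

/-- Seeing the semigroup as the case `b = 0` lets the growth and transform lemmas serve for both
terms of the difference. -/
theorem isMildFundamental_causalExp (a : 𝔸) (τ : ℝ) :
    IsMildFundamental a 0 τ (causalExp a) where
  causal t ht := indicator_of_notMem (by simpa using ht) _
  continuousOn := (continuous_exp_ofReal_smul a).continuousOn.congr
    fun t ht => causalExp_of_nonneg a ht
  eq t ht := by
    have hi : IntervalIntegrable (fun s : ℝ => NormedSpace.exp ((s : ℂ) • a)) volume 0 t :=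
      (continuous_exp_ofReal_smul a).intervalIntegrable _ _
    have h1 := intervalIntegral.integral_eq_sub_of_hasDerivAt
      (fun s _ => hasDerivAt_exp_ofReal_smul a s)
      ((continuous_const.mul (continuous_exp_ofReal_smul a)).intervalIntegrable 0 t)
    have h2 := (ContinuousLinearMap.mul ℂ 𝔸 a).intervalIntegral_comp_comm hi
    simp only [ContinuousLinearMap.mul_apply'] at h2
    rw [intervalIntegral.integral_congr (g := fun s : ℝ => NormedSpace.exp ((s : ℂ) • a))
      fun s hs => causalExp_of_nonneg a (by rw [uIcc_of_le ht] at hs; exact hs.1),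
      causalExp_of_nonneg a ht]
    simp only [ContinuousLinearMap.mul_apply', ← h2, h1]
    simp

/-- On `[0, τ]` the delay term is invisible and the fundamental solution is the semigroup. -/
theorem IsMildFundamental.eq_causalExp (hU : IsMildFundamental a b τ U) {t : ℝ} (ht : t ≤ τ) :
    U t = causalExp a t := by
  have hV := isMildFundamental_causalExp a τ
  rcases lt_or_ge t 0 with h0 | h0
  · rw [hU.causal t h0, hV.causal t h0]
  have hint : ∀ s, ∫ r in (0 : ℝ)..s, (U r - causalExp a r)
      = (∫ r in (0 : ℝ)..s, U r) - ∫ r in (0 : ℝ)..s, causalExp a r := fun s =>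
    intervalIntegral.integral_sub (hU.intervalIntegrable _ _) (hV.intervalIntegrable _ _)
  have hneg : ∀ s < 0, U s - causalExp a s = 0 := fun s hs => by
    rw [hU.causal s hs, hV.causal s hs, sub_zero]
  have hw : ∀ s ∈ Icc 0 t, ‖U s - causalExp a s‖
      ≤ 0 + ‖a‖ * ∫ r in (0 : ℝ)..s, ‖U r - causalExp a r‖ := by
    intro s hs
    have h1 : U s - causalExp a s = a * ∫ r in (0 : ℝ)..s, (U r - causalExp a r) := by
      rw [hint, hU.eq s hs.1, hV.eq s hs.1,
        primitive_of_nonpos hU.causal (by linarith [hs.2] : s - τ ≤ 0)]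
      simp [mul_sub]
    rw [zero_add, h1]
    refine (norm_mul_le _ _).trans ?_
    gcongr
    exact norm_primitive_le hneg s
  have := le_mul_exp_of_le_add_integral (g := fun s => ‖U s - causalExp a s‖) (norm_nonneg a)
    ((hU.continuousOn.sub hV.continuousOn).norm.mono Icc_subset_Ici_self)
    (fun _ _ => norm_nonneg _) hw t ⟨h0, le_rfl⟩
  simpa [sub_eq_zero] using this

/-- The two jumps at `0` cancel, as the difference vanishes up to time `τ`. Fourier inversion at
every point needs this continuity. -/
theorem IsMildFundamental.continuous_sub_causalExp (hτ : 0 < τ)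
    (hU : IsMildFundamental a b τ U) : Continuous fun t => U t - causalExp a t := by
  have hV := isMildFundamental_causalExp a τ
  refine continuous_iff_continuousAt.2 fun t => ?_
  rcases lt_or_ge t τ with h | h
  · refine (continuousAt_const (y := (0 : 𝔸))).congr ?_
    filter_upwards [Iio_mem_nhds h] with s hs
    rw [hU.eq_causalExp (le_of_lt hs), sub_self]
  · exact (hU.continuousOn.sub hV.continuousOn).continuousAt (Ici_mem_nhds (by linarith))

end Semigroup

/-! ### Invertibility of the characteristic matrix and bounds for the difference of resolvents. -/

section Resolvent

variable {n : ℕ} {A B : Matrix (Fin n) (Fin n) ℂ} {τ : ℝ}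

theorem isUnit_and_norm_inv_le {M : Matrix (Fin n) (Fin n) ℂ} {c : ℝ} (hc : 0 < c)
    (h : ∀ v, c * ‖v‖ ≤ ‖Matrix.toEuclideanCLM (𝕜 := ℂ) M v‖) : IsUnit M ∧ ‖M⁻¹‖ ≤ c⁻¹ := by
  have hu : IsUnit M := by
    rw [← Matrix.mulVec_injective_iff_isUnit]
    refine (injective_iff_map_eq_zero (Matrix.mulVecLin M)).2 fun v hv => ?_
    have h1 := h (WithLp.toLp 2 v)
    rw [Matrix.toEuclideanCLM_toLp, show M.mulVec v = 0 from hv] at h1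
    simp only [WithLp.toLp_zero, norm_zero] at h1
    have h2 : ‖WithLp.toLp 2 v‖ = 0 := le_antisymm (by nlinarith) (norm_nonneg _)
    simpa using h2
  refine ⟨hu, ?_⟩
  rw [← Matrix.l2_opNorm_toEuclideanCLM]
  refine ContinuousLinearMap.opNorm_le_bound _ (by positivity) fun v => ?_
  have h1 := h (Matrix.toEuclideanCLM (𝕜 := ℂ) M⁻¹ v)
  rw [← mul_apply_eq_comp, ← map_mul, Matrix.mul_nonsing_inv _
    ((Matrix.isUnit_iff_isUnit_det _).1 hu), map_one, one_apply_eq_self] at h1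
  rwa [← div_eq_inv_mul, le_div_iff₀' hc]

theorem toEuclideanCLM_smul_one_sub_apply (A : Matrix (Fin n) (Fin n) ℂ) (z : ℂ)
    (v : EuclideanSpace ℂ (Fin n)) :
    Matrix.toEuclideanCLM (𝕜 := ℂ) (z • (1 : Matrix (Fin n) (Fin n) ℂ) - A) v
      = z • v - Matrix.toEuclideanCLM (𝕜 := ℂ) A v := by
  rw [map_sub, map_smul, map_one]
  rfl

theorem norm_toEuclideanCLM_apply_le (A : Matrix (Fin n) (Fin n) ℂ)
    (v : EuclideanSpace ℂ (Fin n)) :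
    ‖Matrix.toEuclideanCLM (𝕜 := ℂ) A v‖ ≤ ‖A‖ * ‖v‖ := by
  rw [← Matrix.l2_opNorm_toEuclideanCLM]
  exact ContinuousLinearMap.le_opNorm _ _

/-- For Hermitian `A` the number `⟨v, A v⟩` is real, so `⟨v, (z - A) v⟩` has imaginary part `Im z
‖v‖²`; Cauchy–Schwarz finishes. -/
theorem im_mul_norm_le (hA : A.IsHermitian) (z : ℂ) (v : EuclideanSpace ℂ (Fin n)) :
    |z.im| * ‖v‖ ≤ ‖Matrix.toEuclideanCLM (𝕜 := ℂ) (z • (1 : Matrix (Fin n) (Fin n) ℂ) - A) v‖ := by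
  rcases eq_or_ne v 0 with rfl | hv
  · simp
  rw [toEuclideanCLM_smul_one_sub_apply]
  have hsa : IsSelfAdjoint (Matrix.toEuclideanCLM (𝕜 := ℂ) A) := by
    rw [IsSelfAdjoint, ← map_star]
    exact congrArg _ hA
  have him := hsa.isSymmetric.im_inner_self_apply v
  have h1 : (inner ℂ v (z • v - Matrix.toEuclideanCLM (𝕜 := ℂ) A v)).im = z.im * ‖v‖ ^ 2 := by
    have h2 : (inner ℂ v (Matrix.toEuclideanCLM (𝕜 := ℂ) A v)).im = 0 := him
    rw [inner_sub_right, inner_smul_right, inner_self_eq_norm_sq_to_K, Complex.sub_im, h2, sub_zero]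
    simp [Complex.mul_im, ← Complex.ofReal_pow]
  have h3 := (Complex.abs_im_le_norm _).trans
    (norm_inner_le_norm (𝕜 := ℂ) v (z • v - Matrix.toEuclideanCLM (𝕜 := ℂ) A v))
  rw [h1, abs_mul, abs_of_nonneg (sq_nonneg ‖v‖)] at h3
  have hv' : 0 < ‖v‖ := norm_pos_iff.2 hv
  refine le_of_mul_le_mul_left ?_ hv'
  linarith

theorem norm_sub_mul_norm_le (A : Matrix (Fin n) (Fin n) ℂ) (z : ℂ)
    (v : EuclideanSpace ℂ (Fin n)) :
    (‖z‖ - ‖A‖) * ‖v‖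
      ≤ ‖Matrix.toEuclideanCLM (𝕜 := ℂ) (z • (1 : Matrix (Fin n) (Fin n) ℂ) - A) v‖ := by
  rw [toEuclideanCLM_smul_one_sub_apply]
  have h1 := norm_sub_norm_le (z • v) (Matrix.toEuclideanCLM (𝕜 := ℂ) A v)
  have h2 := norm_toEuclideanCLM_apply_le A v
  rw [norm_smul] at h1
  linarith

theorem norm_cexp_delay (τ : ℝ) (z : ℂ) : ‖Complex.exp (-τ * z)‖ = Real.exp (-τ * z.re) := by
  simp [Complex.norm_exp]

theorem sub_mul_norm_le_charMatrix {c : ℝ} {z : ℂ} {v : EuclideanSpace ℂ (Fin n)}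
    (h : c * ‖v‖
      ≤ ‖Matrix.toEuclideanCLM (𝕜 := ℂ) (z • (1 : Matrix (Fin n) (Fin n) ℂ) - A) v‖) :
    (c - ‖B‖ * Real.exp (-τ * z.re)) * ‖v‖
      ≤ ‖Matrix.toEuclideanCLM (𝕜 := ℂ) (charMatrix A B τ z) v‖ := by
  have h1 := norm_sub_norm_le
    (Matrix.toEuclideanCLM (𝕜 := ℂ) (z • (1 : Matrix (Fin n) (Fin n) ℂ) - A) v)
    (Matrix.toEuclideanCLM (𝕜 := ℂ) (Complex.exp (-τ * z) • B) v)
  have h2 := norm_toEuclideanCLM_apply_le (Complex.exp (-τ * z) • B) v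
  rw [norm_smul, norm_cexp_delay] at h2
  rw [charMatrix, map_sub, sub_apply]
  linarith

/-- The difference `T(z)⁻¹ - R(z)` of the characteristic and the undelayed resolvent. -/
def resolventDiff (A B : Matrix (Fin n) (Fin n) ℂ) (τ : ℝ) (z : ℂ) : Matrix (Fin n) (Fin n) ℂ :=
  (charMatrix A B τ z)⁻¹ - resolventMatrix A z

theorem resolventDiff_eq {z : ℂ} (hT : IsUnit (charMatrix A B τ z))
    (hR : IsUnit (z • (1 : Matrix (Fin n) (Fin n) ℂ) - A)) :
    resolventDiff A B τ z
      = resolventMatrix A z * (Complex.exp (-τ * z) • B) * (charMatrix A B τ z)⁻¹ := by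
  rw [Matrix.isUnit_iff_isUnit_det] at hT hR
  have h : Complex.exp (-τ * z) • B
      = (z • (1 : Matrix (Fin n) (Fin n) ℂ) - A) - charMatrix A B τ z := by
    rw [charMatrix]; abel
  rw [h, mul_sub, sub_mul, resolventMatrix, Matrix.nonsing_inv_mul _ hR, one_mul, mul_assoc,
    Matrix.mul_nonsing_inv _ hT, mul_one, resolventDiff, resolventMatrix]

/-- If `zI - A` is bounded below by `c`, then `T(z)` is bounded below by `c` minus the size of the
delay term. Both are therefore invertible, and the factorisation in `resolventDiff_eq` is estimated
factor by factor. -/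
theorem resolventDiff_bound {z : ℂ} {c : ℝ} (hc : ‖B‖ * Real.exp (-τ * z.re) < c)
    (h : ∀ v, c * ‖v‖
      ≤ ‖Matrix.toEuclideanCLM (𝕜 := ℂ) (z • (1 : Matrix (Fin n) (Fin n) ℂ) - A) v‖) :
    IsUnit (charMatrix A B τ z) ∧ IsUnit (z • (1 : Matrix (Fin n) (Fin n) ℂ) - A) ∧
    ‖resolventDiff A B τ z‖
      ≤ ‖B‖ * Real.exp (-τ * z.re) / (c * (c - ‖B‖ * Real.exp (-τ * z.re))) := by
  have hc0 : 0 < c := lt_of_le_of_lt (by positivity) hc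
  obtain ⟨hR, hRn⟩ := isUnit_and_norm_inv_le hc0 h
  obtain ⟨hT, hTn⟩ := isUnit_and_norm_inv_le (sub_pos.2 hc) fun v =>
    sub_mul_norm_le_charMatrix (B := B) (τ := τ) (h v)
  refine ⟨hT, hR, ?_⟩
  rw [resolventDiff_eq hT hR]
  have hd := sub_pos.2 hc
  calc _ ≤ ‖resolventMatrix A z‖ * ‖Complex.exp (-τ * z) • B‖ * ‖(charMatrix A B τ z)⁻¹‖ :=
        (norm_mul_le _ _).trans (by gcongr; exact norm_mul_le _ _)
    _ ≤ c⁻¹ * (Real.exp (-τ * z.re) * ‖B‖) * (c - ‖B‖ * Real.exp (-τ * z.re))⁻¹ := by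
        rw [norm_smul, norm_cexp_delay]
        gcongr
        exact hRn
    _ = _ := by field_simp

theorem resolventDiff_bound_im (hA : A.IsHermitian) {z : ℂ}
    (hc : ‖B‖ * Real.exp (-τ * z.re) < |z.im|) :
    IsUnit (charMatrix A B τ z) ∧ IsUnit (z • (1 : Matrix (Fin n) (Fin n) ℂ) - A) ∧
    ‖resolventDiff A B τ z‖
      ≤ ‖B‖ * Real.exp (-τ * z.re) / (|z.im| * (|z.im| - ‖B‖ * Real.exp (-τ * z.re))) :=
  resolventDiff_bound hc (im_mul_norm_le hA z)

/-- Here the lower bound is `‖z‖ - ‖A‖`. The threshold on `Re z` makes both factors in the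
denominator at least `‖z‖ / 2`, hence quadratic decay along vertical lines. -/
theorem resolventDiff_bound_right (hτ : 0 < τ) {z : ℂ} (hc : 2 * (‖A‖ + ‖B‖) + 1 ≤ z.re) :
    IsUnit (charMatrix A B τ z) ∧ IsUnit (z • (1 : Matrix (Fin n) (Fin n) ℂ) - A) ∧
    ‖resolventDiff A B τ z‖ ≤ 4 * ‖B‖ * (1 + z.im ^ 2)⁻¹ := by
  have hA := norm_nonneg A
  have hB := norm_nonneg B
  have hz : z.re ≤ ‖z‖ := (le_abs_self _).trans (Complex.abs_re_le_norm z)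
  have hexp : Real.exp (-τ * z.re) ≤ 1 := Real.exp_le_one_iff.2 (by nlinarith)
  have hb : ‖B‖ * Real.exp (-τ * z.re) ≤ ‖B‖ := mul_le_of_le_one_right hB hexp
  obtain ⟨hT, hR, h⟩ := resolventDiff_bound (A := A) (B := B) (τ := τ) (z := z) (c := ‖z‖ - ‖A‖)
    (by linarith) (norm_sub_mul_norm_le A z)
  refine ⟨hT, hR, h.trans ?_⟩
  have hsq : 1 + z.im ^ 2 ≤ ‖z‖ ^ 2 := by
    rw [Complex.sq_norm, Complex.normSq_apply]
    nlinarith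
  have hp : 0 < 1 + z.im ^ 2 := by positivity
  calc _ ≤ ‖B‖ / ((‖z‖ / 2) * (‖z‖ / 2)) := by
        gcongr
        · linarith
        · linarith
        · linarith
        · linarith
    _ = 4 * ‖B‖ * (‖z‖ ^ 2)⁻¹ := by
        have : ‖z‖ ≠ 0 := by linarith
        field_simp; ring
    _ ≤ _ := by gcongr

theorem differentiableAt_resolventDiff {z : ℂ} (hT : IsUnit (charMatrix A B τ z))
    (hR : IsUnit (z • (1 : Matrix (Fin n) (Fin n) ℂ) - A)) :
    DifferentiableAt ℂ (resolventDiff A B τ) z := by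
  have h1 : DifferentiableAt ℂ (charMatrix A B τ) z := by
    unfold charMatrix
    fun_prop
  have h2 : DifferentiableAt ℂ (fun z : ℂ => z • (1 : Matrix (Fin n) (Fin n) ℂ) - A) z := by
    fun_prop
  have h3 := (differentiableAt_inverse (𝕜 := ℂ) hT).comp z h1
  have h4 := (differentiableAt_inverse (𝕜 := ℂ) hR).comp z h2
  refine (h3.sub h4).congr_of_eventuallyEq (.of_forall fun w => ?_)
  simp [resolventDiff, resolventMatrix, Matrix.nonsing_inv_eq_ringInverse]

theorem isUnit_of_abscissa_lt {T : ℂ → Matrix (Fin n) (Fin n) ℂ}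
    (h0 : abscissa (eigenvalues T) < 0) {z : ℂ} (hz : abscissa (eigenvalues T) < z.re) :
    IsUnit (T z) := by
  by_contra h
  have hb : BddAbove (Complex.re '' eigenvalues T) := by
    -- An unbounded set would have supremum `0` by convention, which the negative abscissa excludes.
    by_contra hb
    rw [abscissa, Real.sSup_of_not_bddAbove hb] at h0
    exact lt_irrefl _ h0
  exact absurd (le_csSup hb (mem_image_of_mem _ h)) (not_le.2 hz)

theorem matrixAbscissa_eq (A : Matrix (Fin n) (Fin n) ℂ) :
    matrixAbscissa A
      = abscissa (eigenvalues fun z => z • (1 : Matrix (Fin n) (Fin n) ℂ) - A) := by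
  rw [matrixAbscissa]
  congr 1
  ext z
  rw [spectrum.mem_iff, Algebra.algebraMap_eq_smul_one]
  rfl

end Resolvent

/-- Inversion of the Laplace transform of the difference of the fundamental solution and the
semigroup along a vertical line far to the right. -/
theorem fundamental_sub_causalExp_eq {n : ℕ} {A B : Matrix (Fin n) (Fin n) ℂ} {τ : ℝ}
    {U : ℝ → Matrix (Fin n) (Fin n) ℂ} (hτ : 0 < τ) (hU : IsMildFundamental A B τ U) {c : ℝ}
    (hc : 2 * (‖A‖ + ‖B‖) + 2 ≤ c) (t : ℝ) :
    Integrable (fun y : ℝ => Complex.exp ((c + y * Complex.I) * t)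
      • resolventDiff A B τ (c + y * Complex.I)) ∧
    U t - causalExp A t = (1 / (2 * Real.pi)) • ∫ y : ℝ, Complex.exp ((c + y * Complex.I) * t)
      • resolventDiff A B τ (c + y * Complex.I) := by
  have hA := norm_nonneg A
  have hB := norm_nonneg B
  have hV := isMildFundamental_causalExp A τ
  have hre : ∀ y : ℝ, ((c : ℂ) + y * Complex.I).re = c := fun y => by simp
  have him : ∀ y : ℝ, ((c : ℂ) + y * Complex.I).im = y := fun y => by simp
  have hbd := fun y : ℝ => resolventDiff_bound_right (A := A) (B := B) hτ
    (z := c + y * Complex.I) (by rw [hre]; linarith)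
  have hcont : Continuous fun y : ℝ => resolventDiff A B τ (c + y * Complex.I) := by
    refine continuous_iff_continuousAt.2 fun y => ?_
    exact (differentiableAt_resolventDiff (hbd y).1 (hbd y).2.1).continuousAt.comp
      (f := fun y : ℝ => (c : ℂ) + y * Complex.I) (by fun_prop)
  have hDi : Integrable fun y : ℝ => resolventDiff A B τ (c + y * Complex.I) := by
    refine (integrable_inv_one_add_sq.const_mul (4 * ‖B‖)).mono' hcont.aestronglyMeasurable
      (.of_forall fun y => ?_)
    have := (hbd y).2.2
    rwa [him] at this
  have hUL : ∀ z : ℂ, ‖A‖ + ‖B‖ + 1 < z.re →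
      Integrable fun t : ℝ => Complex.exp (-z * t) • U t := fun z hz =>
    integrable_laplace hU.causal hU.stronglyMeasurable (hU.norm_le hτ.le le_rfl) (by linarith)
  have hVL : ∀ z : ℂ, ‖A‖ + ‖B‖ + 1 < z.re →
      Integrable fun t : ℝ => Complex.exp (-z * t) • causalExp A t := fun z hz =>
    integrable_laplace hV.causal hV.stronglyMeasurable (hV.norm_le hτ.le le_rfl)
      (by rw [norm_zero]; linarith)
  have hG : ∀ y : ℝ, laplace (fun t => U t - causalExp A t) (c + y * Complex.I)
      = resolventDiff A B τ (c + y * Complex.I) := by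
    intro y
    have h1 := hU.mul_laplace hτ.le (z := c + y * Complex.I) (by rw [hre]; linarith)
    have h2 := hV.mul_laplace hτ.le (z := c + y * Complex.I) (by rw [hre, norm_zero]; linarith)
    rw [smul_zero, sub_zero] at h2
    rw [resolventDiff, resolventMatrix, charMatrix, Matrix.inv_eq_right_inv h1,
      Matrix.inv_eq_right_inv h2, laplace]
    simp only [smul_sub]
    exact integral_sub (hUL _ (by rw [hre]; linarith)) (hVL _ (by rw [hre]; linarith))
  refine ⟨?_, laplace_inversion (hU.continuous_sub_causalExp hτ) ?_ hG hDi t⟩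
  · refine (hDi.norm.const_mul (Real.exp (c * t))).mono' ?_ (.of_forall fun y => ?_)
    · have h : Continuous fun y : ℝ => Complex.exp ((c + y * Complex.I) * t) := by fun_prop
      exact (h.smul hcont).aestronglyMeasurable
    · rw [norm_smul, Complex.norm_exp]
      simp
  · have := (hUL c (by rw [Complex.ofReal_re]; linarith)).sub
      (hVL c (by rw [Complex.ofReal_re]; linarith))
    refine this.congr (.of_forall fun s => ?_)
    simp [smul_sub]

/-! ### The logarithmic curve and the deformation of the contour. -/

section Contour

theorem exp_neg_mul_x₀ {τ y η : ℝ} (hτ : 0 < τ) (hy : 0 < η * y) :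
    Real.exp (-τ * x₀ τ y η) = η * y := by
  rw [x₀, show -τ * (-(1 / τ) * Real.log (η * y)) = Real.log (η * y) by field_simp,
    Real.exp_log hy]

theorem hasDerivAt_x₀ {τ y η : ℝ} (hη : η ≠ 0) (hy : y ≠ 0) :
    HasDerivAt (fun y => x₀ τ y η) (-(τ * y)⁻¹) y := by
  have h1 : HasDerivAt (fun y : ℝ => η * y) η y := by
    simpa using (hasDerivAt_id y).const_mul η
  have h2 := (h1.log (mul_ne_zero hη hy)).const_mul (-(1 / τ))
  refine h2.congr_deriv ?_
  field_simp

theorem x₀_antitone {τ η y Y : ℝ} (hτ : 0 < τ) (hη : 0 < η) (hy : 0 < y) (hyY : y ≤ Y) :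
    x₀ τ Y η ≤ x₀ τ y η := by
  have h : Real.log (η * y) ≤ Real.log (η * Y) := Real.log_le_log (by positivity) (by gcongr)
  have h1 : 0 < 1 / τ := by positivity
  rw [x₀, x₀]
  nlinarith

/-- A strict sublevel set of the convex function `b e^{-τ Re z} - σ Im z`. Convexity provides a
global primitive for holomorphic functions on the region. -/
theorem convex_delay_region {b : ℝ} (hb : 0 ≤ b) (τ σ : ℝ) :
    Convex ℝ {z : ℂ | b * Real.exp (-τ * z.re) < σ * z.im} := by
  intro z hz w hw p q hp hq hpq
  rw [mem_ofPred_eq] at hz hw ⊢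
  have h := convexOn_exp.2 (mem_univ (-τ * z.re)) (mem_univ (-τ * w.re)) hp hq hpq
  have h' := mul_le_mul_of_nonneg_left h hb
  simp only [smul_eq_mul] at h'
  simp only [Complex.add_re, Complex.add_im, Complex.real_smul, Complex.re_ofReal_mul,
    Complex.im_ofReal_mul]
  rw [show -τ * (p * z.re + q * w.re) = p * (-τ * z.re) + q * (-τ * w.re) by ring]
  rcases hp.eq_or_lt with rfl | hp'
  · have hq1 : q = 1 := by linarith
    subst hq1
    linarith
  · nlinarith [mul_lt_mul_of_pos_left hz hp', mul_le_mul_of_nonneg_left hw.le hq]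

theorem isOpen_delay_region (b τ σ : ℝ) :
    IsOpen {z : ℂ | b * Real.exp (-τ * z.re) < σ * z.im} :=
  isOpen_lt (by fun_prop) (by fun_prop)

variable {E : Type*} [NormedAddCommGroup E] [NormedSpace ℂ E] [CompleteSpace E]

/-- The integral of the derivative of `F` along a path. -/
theorem integral_path_eq_sub {f F : ℂ → E} {s : Set ℂ} (hf : ContinuousOn f s)
    (hF : ∀ z ∈ s, HasDerivAt F (f z) z) {p p' : ℝ → ℂ} {u v : ℝ}
    (hp : ∀ y ∈ uIcc u v, HasDerivAt p (p' y) y) (hps : ∀ y ∈ uIcc u v, p y ∈ s)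
    (hp' : ContinuousOn p' (uIcc u v)) :
    ∫ y in u..v, p' y • f (p y) = F (p v) - F (p u) := by
  have hpc : ContinuousOn p (uIcc u v) := fun y hy => (hp y hy).continuousAt.continuousWithinAt
  exact intervalIntegral.integral_eq_sub_of_hasDerivAt (f := F ∘ p)
    (fun y hy => (hF _ (hps y hy)).scomp y (hp y hy))
    (hp'.smul (hf.comp hpc hps)).intervalIntegrable

/-- Deformation of a vertical half-line, truncated at height `Y`, to the curve
`x = -(1/τ) log (η y)`. -/
theorem integral_branch_eq {g : ℂ → E} {b τ η σ y₀ Y c : ℝ} (hb : 0 ≤ b) (hτ : 0 < τ)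
    (hη : 0 < η) (hbη : b * η < 1) (hσ : σ * σ = 1) (hy₀ : 0 < y₀) (hY : y₀ ≤ Y)
    (hc : x₀ τ y₀ η ≤ c)
    (hg : ∀ z : ℂ, b * Real.exp (-τ * z.re) < σ * z.im → DifferentiableAt ℂ g z) :
    (∫ y in y₀..Y, (σ * Complex.I : ℂ) • g (c + σ * y * Complex.I))
      + ∫ x in (x₀ τ y₀ η)..c, g (x + σ * y₀ * Complex.I)
    = (∫ y in y₀..Y, ((-(τ * y)⁻¹ : ℝ) + σ * Complex.I : ℂ)
        • g (x₀ τ y η + σ * y * Complex.I))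
      + ∫ x in (x₀ τ Y η)..c, g (x + σ * Y * Complex.I) := by
  set s : Set ℂ := {z : ℂ | b * Real.exp (-τ * z.re) < σ * z.im} with hs
  have hY0 : 0 < Y := hy₀.trans_le hY
  have hso : IsOpen s := isOpen_delay_region b τ σ
  obtain ⟨F, hF'⟩ := (convex_delay_region hb τ σ).exists_forall_hasDerivWithinAt (f := g)
    fun z hz => (hg z hz).differentiableWithinAt
  have hF : ∀ z ∈ s, HasDerivAt F (g z) z := fun z hz =>
    (hF' z hz).hasDerivAt (hso.mem_nhds hz)
  have hgc : ContinuousOn g s := fun z hz => (hg z hz).continuousAt.continuousWithinAt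
  -- On the curve `e^{-τx} = η y`, and further right it is smaller; `b η < 1` then places these
  -- points in the region.
  have hmem : ∀ x y : ℝ, 0 < y → x₀ τ y η ≤ x → (x + σ * y * Complex.I : ℂ) ∈ s := by
    intro x y hy hx
    have h1 : Real.exp (-τ * x) ≤ η * y := by
      rw [← exp_neg_mul_x₀ hτ (by positivity : 0 < η * y)]
      exact Real.exp_le_exp.2 (by nlinarith)
    have h2 : σ * (σ * y) = y := by rw [← mul_assoc, hσ, one_mul]
    simp only [hs, mem_ofPred_eq, Complex.add_re, Complex.add_im, Complex.ofReal_re,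
      Complex.ofReal_im, Complex.mul_re, Complex.mul_im, Complex.I_re, Complex.I_im, mul_zero,
      mul_one, sub_self, add_zero, zero_mul, zero_add, sub_zero, h2]
    calc b * Real.exp (-τ * x) ≤ b * (η * y) := by gcongr
      _ = b * η * y := by ring
      _ < 1 * y := by gcongr
      _ = y := one_mul y
  have hpos : ∀ y ∈ uIcc y₀ Y, y₀ ≤ y := fun y hy => by rw [uIcc_of_le hY] at hy; exact hy.1
  have hvert : ∀ y : ℝ, HasDerivAt (fun y : ℝ => (σ * y * Complex.I : ℂ)) (σ * Complex.I) y := by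
    intro y
    have := ((hasDerivAt_id (y : ℂ)).const_mul (σ : ℂ)).mul_const Complex.I
    simpa using this.comp_ofReal
  have hhor : ∀ k : ℂ, ∀ x : ℝ, HasDerivAt (fun x : ℝ => (x + k : ℂ)) 1 x := by
    intro k x
    simpa using ((hasDerivAt_id (x : ℂ)).add_const k).comp_ofReal
  have e1 := integral_path_eq_sub hgc hF (p := fun y => c + σ * y * Complex.I)
    (p' := fun _ => σ * Complex.I) (u := y₀) (v := Y) (fun y _ => (hvert y).const_add _)
    (fun y hy => hmem c y (hy₀.trans_le (hpos y hy))
      ((x₀_antitone hτ hη hy₀ (hpos y hy)).trans hc)) continuousOn_const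
  have e2 : ∀ y, y₀ ≤ y → ∫ x in (x₀ τ y η)..c, g (x + σ * y * Complex.I)
      = F (c + σ * y * Complex.I) - F (x₀ τ y η + σ * y * Complex.I) := by
    intro y hy
    have hle : x₀ τ y η ≤ c := (x₀_antitone hτ hη hy₀ hy).trans hc
    have := integral_path_eq_sub hgc hF (p := fun x => x + σ * y * Complex.I)
      (p' := fun _ => 1) (u := x₀ τ y η) (v := c) (fun x _ => hhor _ x)
      (fun x hx => hmem x y (hy₀.trans_le hy) (by rw [uIcc_of_le hle] at hx; exact hx.1))
      continuousOn_const
    simpa using this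
  have e3 := integral_path_eq_sub hgc hF (p := fun y => x₀ τ y η + σ * y * Complex.I)
    (p' := fun y => (-(τ * y)⁻¹ : ℝ) + σ * Complex.I) (u := y₀) (v := Y)
    (fun y hy => ((hasDerivAt_x₀ hη.ne' (hy₀.trans_le (hpos y hy)).ne').ofReal_comp).add (hvert y))
    (fun y hy => hmem _ y (hy₀.trans_le (hpos y hy)) le_rfl)
    (by
      have : ContinuousOn (fun y : ℝ => (τ * y)⁻¹) (uIcc y₀ Y) :=
        ContinuousOn.inv₀ (by fun_prop) fun y hy =>
          (mul_pos hτ (hy₀.trans_le (hpos y hy))).ne'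
      fun_prop)
  rw [e1, e2 y₀ le_rfl, e3, e2 Y hY]
  abel

/-- `D` is holomorphic and bounded as the difference of resolvents is on the region
`b e^{-τ Re z} < |Im z|`. -/
def DelayBounded (b τ : ℝ) (D : ℂ → E) : Prop :=
  ∀ z : ℂ, b * Real.exp (-τ * z.re) < |z.im| → DifferentiableAt ℂ D z ∧
    ‖D z‖ ≤ b * Real.exp (-τ * z.re) / (|z.im| * (|z.im| - b * Real.exp (-τ * z.re)))

end Contour

/-! ### Estimates on the curve and on the closing horizontal segments. -/

section Estimates

variable {E : Type*} [NormedAddCommGroup E] [NormedSpace ℂ E] {D : ℂ → E}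
  {b τ η t σ y₀ Y c : ℝ}

theorem DelayBounded.norm_le (hD : DelayBounded b τ D) (hb : 0 ≤ b) (hτ : 0 < τ)
    (hη : 0 < η) (hbη : b * η < 1) (hσ : |σ| = 1) {x y : ℝ} (hy : 0 < y)
    (hx : x₀ τ y η ≤ x) :
    ‖Complex.exp ((x + σ * y * Complex.I) * t) • D (x + σ * y * Complex.I)‖
      ≤ Real.exp (x * t) * (b * Real.exp (-τ * x) / (y * (y * (1 - b * η)))) := by
  have h1 : Real.exp (-τ * x) ≤ η * y := by
    rw [← exp_neg_mul_x₀ hτ (by positivity : 0 < η * y)]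
    exact Real.exp_le_exp.2 (by nlinarith)
  have h2 : b * Real.exp (-τ * x) ≤ y * (b * η) := by
    calc _ ≤ b * (η * y) := by gcongr
      _ = _ := by ring
  have hbp : 0 < 1 - b * η := by linarith
  have hre : ((x : ℂ) + σ * y * Complex.I).re = x := by simp
  have him : |((x : ℂ) + σ * y * Complex.I).im| = y := by
    simp [abs_mul, hσ, abs_of_pos hy]
  have hlt : b * Real.exp (-τ * x) < y := by nlinarith
  have h3 := (hD (x + σ * y * Complex.I) (by rw [hre, him]; exact hlt)).2
  rw [hre, him] at h3
  rw [norm_smul, Complex.norm_exp]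
  have h4 : (((x : ℂ) + σ * y * Complex.I) * t).re = x * t := by simp
  rw [h4]
  gcongr
  refine h3.trans ?_
  gcongr
  linarith

/-- The speed of the curve is largest at `y₀`, and the integrand is at most `K e^{x(y)t} / y`. Since
`x'(y) = -1/(τy)`, this majorant has an explicit antiderivative, which is the source of the factor
`τ / t`. -/
theorem DelayBounded.norm_integral_curve_le (hD : DelayBounded b τ D) (hb : 0 ≤ b) (hτ : 0 < τ)
    (hη : 0 < η) (hbη : b * η < 1) (hσ : |σ| = 1) (hy₀ : 0 < y₀) (hY : y₀ ≤ Y) (ht : 0 < t) :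
    ‖∫ y in y₀..Y, ((-(τ * y)⁻¹ : ℝ) + σ * Complex.I : ℂ)
        • (Complex.exp ((x₀ τ y η + σ * y * Complex.I) * t)
          • D (x₀ τ y η + σ * y * Complex.I))‖
      ≤ Real.sqrt (((τ * y₀) ^ 2)⁻¹ + 1) * (b * η / (1 - b * η)) * (τ / t)
        * Real.exp (x₀ τ y₀ η * t) := by
  set K := Real.sqrt (((τ * y₀) ^ 2)⁻¹ + 1) * (b * η / (1 - b * η)) with hK
  have hbp : 0 < 1 - b * η := by linarith
  have hK0 : 0 ≤ K := by positivity
  have hd : ∀ y ∈ uIcc y₀ Y, HasDerivAt (fun y => -(K * (τ / t) * Real.exp (x₀ τ y η * t)))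
      (K * (Real.exp (x₀ τ y η * t) / y)) y := by
    intro y hy
    rw [uIcc_of_le hY] at hy
    have hy0 : 0 < y := hy₀.trans_le hy.1
    have h := ((((hasDerivAt_x₀ (τ := τ) hη.ne' hy0.ne').mul_const t).exp).const_mul
      (K * (τ / t))).neg
    refine h.congr_deriv ?_
    field_simp
  have hcx : ContinuousOn (fun y => x₀ τ y η) (uIcc y₀ Y) := by
    intro y hy
    rw [uIcc_of_le hY] at hy
    exact (hasDerivAt_x₀ (τ := τ) hη.ne'
      (hy₀.trans_le hy.1).ne').continuousAt.continuousWithinAt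
  have hci : IntervalIntegrable (fun y => K * (Real.exp (x₀ τ y η * t) / y)) volume y₀ Y := by
    refine ContinuousOn.intervalIntegrable ?_
    refine continuousOn_const.mul (ContinuousOn.div (by fun_prop) continuousOn_id fun y hy => ?_)
    rw [uIcc_of_le hY] at hy
    exact (hy₀.trans_le hy.1).ne'
  have hval := intervalIntegral.integral_eq_sub_of_hasDerivAt hd hci
  refine (intervalIntegral.norm_integral_le_of_norm_le hY (.of_forall fun y hy => ?_) hci).trans ?_
  · have hy0 : 0 < y := hy₀.trans hy.1
    have h1 := hD.norm_le (t := t) hb hτ hη hbη hσ hy0 le_rfl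
    rw [exp_neg_mul_x₀ hτ (by positivity : 0 < η * y)] at h1
    have h2 : ‖((-(τ * y)⁻¹ : ℝ) + σ * Complex.I : ℂ)‖ ≤ Real.sqrt (((τ * y₀) ^ 2)⁻¹ + 1) := by
      rw [Complex.norm_add_mul_I]
      refine Real.sqrt_le_sqrt ?_
      have h3 : σ ^ 2 = 1 := by rw [← sq_abs, hσ, one_pow]
      rw [h3, neg_sq, inv_pow]
      gcongr
      exact hy.1.le
    rw [norm_smul]
    calc _ ≤ Real.sqrt (((τ * y₀) ^ 2)⁻¹ + 1) * (Real.exp (x₀ τ y η * t)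
          * (b * (η * y) / (y * (y * (1 - b * η))))) := by gcongr
      _ = _ := by rw [hK]; field_simp
  · rw [hval]
    have : 0 ≤ K * (τ / t) * Real.exp (x₀ τ Y η * t) := by positivity
    linarith

/-- The factors `e^{xt}` and `e^{-τx}` combine to `e^{x(t-τ)}`, which is bounded for `x ≤ c` because
`t ≥ τ`. The length grows logarithmically, so a crude linear bound still loses to `Y²`. -/
theorem DelayBounded.norm_integral_horizontal_le (hD : DelayBounded b τ D) (hb : 0 ≤ b)
    (hτ : 0 < τ) (hη : 0 < η) (hbη : b * η < 1) (hσ : |σ| = 1) (hY : 0 < Y) (hc : x₀ τ Y η ≤ c)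
    (ht : τ ≤ t) :
    ‖∫ x in (x₀ τ Y η)..c, Complex.exp ((x + σ * Y * Complex.I) * t)
        • D (x + σ * Y * Complex.I)‖
      ≤ Real.exp (c * (t - τ)) * b / (1 - b * η) * ((c + η * Y / τ) / Y ^ 2) := by
  have hbp : 0 < 1 - b * η := by linarith
  have hn := intervalIntegral.norm_integral_le_of_norm_le_const (a := x₀ τ Y η) (b := c)
    (C := Real.exp (c * (t - τ)) * b / (1 - b * η) / Y ^ 2)
    (f := fun x : ℝ => Complex.exp ((x + σ * Y * Complex.I) * t) • D (x + σ * Y * Complex.I))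
    (fun x hx => by
      rw [uIoc_of_le hc] at hx
      refine (hD.norm_le hb hτ hη hbη hσ hY hx.1.le).trans ?_
      calc _ = (Real.exp (x * t) * Real.exp (-τ * x)) * b / (1 - b * η) / Y ^ 2 := by
            field_simp
        _ = Real.exp (x * (t - τ)) * b / (1 - b * η) / Y ^ 2 := by
            rw [← Real.exp_add]; ring_nf
        _ ≤ _ := by
            have h1 : 0 ≤ t - τ := sub_nonneg.2 ht
            have h2 : x ≤ c := hx.2
            gcongr)
  refine hn.trans ?_
  rw [abs_of_nonneg (sub_nonneg.2 hc)]
  have hlog : c - x₀ τ Y η ≤ c + η * Y / τ := by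
    have h := (Real.log_le_sub_one_of_pos (by positivity : 0 < η * Y)).trans
      (sub_le_self _ zero_le_one)
    have h2 : 1 / τ * Real.log (η * Y) ≤ 1 / τ * (η * Y) := by gcongr
    rw [x₀]
    calc _ = c + 1 / τ * Real.log (η * Y) := by ring
      _ ≤ c + 1 / τ * (η * Y) := by linarith
      _ = _ := by ring
  calc _ ≤ Real.exp (c * (t - τ)) * b / (1 - b * η) / Y ^ 2 * (c + η * Y / τ) := by gcongr
    _ = _ := by ring

end Estimates

/-- Bound of the inverse Laplace integral along `Re z = c` by the deformed contour. -/
theorem norm_integral_line_le {E : Type*} [NormedAddCommGroup E] [NormedSpace ℂ E]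
    [CompleteSpace E] {D : ℂ → E} {b τ η t y₀ c : ℝ} (hD : DelayBounded b τ D) (hb : 0 ≤ b)
    (hτ : 0 < τ) (hη : 0 < η) (hbη : b * η < 1) (hy₀ : 0 < y₀) (hc : x₀ τ y₀ η ≤ c)
    (ht : τ ≤ t) (hDr : ∀ z : ℂ, x₀ τ y₀ η ≤ z.re → DifferentiableAt ℂ D z)
    (hi : Integrable fun y : ℝ => Complex.exp ((c + y * Complex.I) * t)
      • D (c + y * Complex.I)) :
    ‖∫ y : ℝ, Complex.exp ((c + y * Complex.I) * t) • D (c + y * Complex.I)‖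
      ≤ Real.exp (x₀ τ y₀ η * t) * (∫ y in (-y₀)..y₀, ‖D (x₀ τ y₀ η + y * Complex.I)‖)
        + 2 * (Real.sqrt (((τ * y₀) ^ 2)⁻¹ + 1) * (b * η / (1 - b * η)) * (τ / t)
        * Real.exp (x₀ τ y₀ η * t)) := by
  set a := x₀ τ y₀ η with ha
  set g : ℂ → E := fun z => Complex.exp (z * t) • D z with hg
  set K := Real.sqrt (((τ * y₀) ^ 2)⁻¹ + 1) * (b * η / (1 - b * η)) * (τ / t)
        * Real.exp (a * t) with hK
  have hexp : ∀ z : ℂ, DifferentiableAt ℂ (fun z : ℂ => Complex.exp (z * t)) z := fun z => by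
    fun_prop
  have hgr : ∀ z : ℂ, a ≤ z.re → DifferentiableAt ℂ g z := fun z hz => (hexp z).smul (hDr z hz)
  have hgb : ∀ σ : ℝ, |σ| = 1 → ∀ z : ℂ, b * Real.exp (-τ * z.re) < σ * z.im →
      DifferentiableAt ℂ g z := by
    intro σ hσ z hz
    refine (hexp z).smul (hD z (hz.trans_le ?_)).1
    calc σ * z.im ≤ |σ * z.im| := le_abs_self _
      _ = |z.im| := by rw [abs_mul, hσ, one_mul]
  -- the vertical segment
  have hmid : ‖∫ y in (-y₀)..y₀, g (a + y * Complex.I)‖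
      ≤ Real.exp (a * t) * ∫ y in (-y₀)..y₀, ‖D (a + y * Complex.I)‖ := by
    refine (intervalIntegral.norm_integral_le_integral_norm (by linarith)).trans ?_
    rw [← intervalIntegral.integral_const_mul]
    refine le_of_eq (intervalIntegral.integral_congr fun y _ => ?_)
    simp [hg, norm_smul, Complex.norm_exp]
  -- The rectangle between the segment and the line; its horizontal sides cancel those at height
  -- `±y₀` in the two branch identities.
  have hrect := Complex.integral_boundary_rect_eq_zero_of_differentiableOn g
    (a - y₀ * Complex.I) (c + y₀ * Complex.I) (fun z hz => by
      refine (hgr z ?_).differentiableWithinAt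
      have := hz.1
      simp only [mem_preimage] at this
      rw [uIcc_of_le (by simpa using hc)] at this
      simpa using this.1)
  simp only [Complex.sub_re, Complex.sub_im, Complex.add_re, Complex.add_im, Complex.ofReal_re,
    Complex.ofReal_im, Complex.mul_re, Complex.mul_im, Complex.I_re, Complex.I_im, mul_zero,
    mul_one, sub_zero, zero_sub, zero_add, add_zero, sub_self, Complex.ofReal_neg, neg_mul] at hrect
  have hline : ∀ u v : ℝ, IntervalIntegrable (fun y : ℝ => g (c + y * Complex.I)) volume u v :=
    fun u v => hi.intervalIntegrable
  have hY : ∀ Y, y₀ ≤ Y → ‖∫ y in (-Y)..Y, g (c + y * Complex.I)‖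
      ≤ Real.exp (a * t) * (∫ y in (-y₀)..y₀, ‖D (a + y * Complex.I)‖) + 2 * K
        + 2 * (Real.exp (c * (t - τ)) * b / (1 - b * η) * ((c + η * Y / τ) / Y ^ 2)) := by
    intro Y hY
    have hY0 : 0 < Y := hy₀.trans_le hY
    have hcY : x₀ τ Y η ≤ c := (x₀_antitone hτ hη hy₀ hY).trans hc
    have up := integral_branch_eq (σ := 1) hb hτ hη hbη (by norm_num) hy₀ hY hc
      (hgb 1 (by norm_num))
    have dn := integral_branch_eq (σ := -1) hb hτ hη hbη (by norm_num) hy₀ hY hc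
      (hgb (-1) (by norm_num))
    have cu := hD.norm_integral_curve_le (σ := 1) hb hτ hη hbη (by norm_num) hy₀ hY
      (hτ.trans_le ht)
    have cd := hD.norm_integral_curve_le (σ := -1) hb hτ hη hbη (by norm_num) hy₀ hY
      (hτ.trans_le ht)
    have hu := hD.norm_integral_horizontal_le (σ := 1) hb hτ hη hbη (by norm_num) hY0 hcY ht
    have hd := hD.norm_integral_horizontal_le (σ := -1) hb hτ hη hbη (by norm_num) hY0 hcY ht
    change ‖∫ y in y₀..Y, _ • g _‖ ≤ K at cu cd
    change ‖∫ x in _..c, g _‖ ≤ _ at hu hd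
    rw [intervalIntegral.integral_smul, ← ha] at up dn
    simp only [Complex.ofReal_neg, Complex.ofReal_one, one_mul, neg_mul, neg_smul]
      at up dn cu cd hu hd
    have hsplit : ∫ y in (-Y)..Y, g (c + y * Complex.I)
        = (∫ y in y₀..Y, g (c + -(y * Complex.I))) + (∫ y in (-y₀)..y₀, g (c + y * Complex.I))
          + ∫ y in y₀..Y, g (c + y * Complex.I) := by
      have h1 := intervalIntegral.integral_comp_neg (a := y₀) (b := Y)
        (fun y : ℝ => g (c + y * Complex.I))
      simp only [Complex.ofReal_neg, neg_mul] at h1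
      rw [h1, intervalIntegral.integral_add_adjacent_intervals (hline _ _) (hline _ _),
        intervalIntegral.integral_add_adjacent_intervals (hline _ _) (hline _ _)]
    -- The factor `I` has norm one and turns `dy` into `dz`, so that the three contour identities
    -- add up.
    have hI : ‖∫ y in (-Y)..Y, g (c + y * Complex.I)‖
        = ‖Complex.I • ∫ y in (-Y)..Y, g (c + y * Complex.I)‖ := by
      rw [norm_smul, Complex.norm_I, one_mul]
    have hI' : ‖∫ y in (-y₀)..y₀, g (a + y * Complex.I)‖
        = ‖Complex.I • ∫ y in (-y₀)..y₀, g (a + y * Complex.I)‖ := by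
      rw [norm_smul, Complex.norm_I, one_mul]
    rw [hI'] at hmid
    rw [hI, hsplit, smul_add, smul_add]
    set p1 := Complex.I • ∫ y in y₀..Y, g (c + -(y * Complex.I))
    set p2 := Complex.I • ∫ y in (-y₀)..y₀, g (c + y * Complex.I)
    set p3 := Complex.I • ∫ y in y₀..Y, g (c + y * Complex.I)
    have hsum : p1 + p2 + p3 = Complex.I • (∫ y in (-y₀)..y₀, g (a + y * Complex.I))
        + (∫ y in y₀..Y, (-((τ * y)⁻¹ : ℝ) + Complex.I : ℂ)
          • g (x₀ τ y η + y * Complex.I))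
        - (∫ y in y₀..Y, (-((τ * y)⁻¹ : ℝ) + -Complex.I : ℂ)
          • g (x₀ τ y η + -(y * Complex.I)))
        + (∫ x in (x₀ τ Y η)..c, g (x + Y * Complex.I))
        - ∫ x in (x₀ τ Y η)..c, g (x + -(Y * Complex.I)) := by
      linear_combination (norm := module) up - dn + hrect
    rw [hsum]
    refine (norm_sub_le _ _).trans ?_
    refine (add_le_add_left (norm_add_le _ _) _).trans ?_
    refine (add_le_add_left (add_le_add_left (norm_sub_le _ _) _) _).trans ?_
    refine (add_le_add_left (add_le_add_left (add_le_add_left (norm_add_le _ _) _) _) _).trans ?_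
    linarith
  have hlim := intervalIntegral_tendsto_integral hi Filter.tendsto_neg_atTop_atBot
    Filter.tendsto_id
  have hzero : Filter.Tendsto (fun Y : ℝ => (c + η * Y / τ) / Y ^ 2) Filter.atTop (nhds 0) := by
    have h1 : Filter.Tendsto (fun Y : ℝ => c * Y⁻¹ * Y⁻¹ + η / τ * Y⁻¹) Filter.atTop (nhds 0) := by
      have h := tendsto_inv_atTop_zero (𝕜 := ℝ)
      simpa using ((h.const_mul c).mul h).add (h.const_mul (η / τ))
    refine h1.congr' ?_
    filter_upwards [Filter.eventually_gt_atTop 0] with Y hY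
    field_simp
  have hbound := ((hzero.const_mul (Real.exp (c * (t - τ)) * b / (1 - b * η))).const_mul 2).const_add
    (Real.exp (a * t) * (∫ y in (-y₀)..y₀, ‖D (a + y * Complex.I)‖) + 2 * K)
  rw [mul_zero, mul_zero, add_zero] at hbound
  exact le_of_tendsto_of_tendsto hlim.norm hbound
    (by filter_upwards [Filter.eventually_ge_atTop y₀] with Y h using hY Y h)

/-! ### The contour estimate for the fundamental solution. -/

section Fundamental

variable {n : ℕ} {A B : Matrix (Fin n) (Fin n) ℂ} {τ y₀ η : ℝ}

/-- Turns the exponential conditions on `η y₀` into the statement that the vertical segment lies to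
the right of the spectra. -/
theorem lt_x₀_of_lt_exp {α : ℝ} (hτ : 0 < τ) (h0 : 0 < η * y₀)
    (h : η * y₀ < Real.exp (-α * τ)) : α < x₀ τ y₀ η := by
  have h1 := (Real.log_lt_iff_lt_exp h0).2 h
  rw [x₀, show -(1 / τ) * Real.log (η * y₀) = -Real.log (η * y₀) / τ by ring, lt_div_iff₀ hτ]
  linarith

theorem Admissible.eta_pos (h : Admissible A B τ y₀ η) : 0 < η :=
  pos_of_mul_pos_left (zero_lt_one.trans h.one_lt) h.y₀_pos.le

theorem Admissible.x₀_neg (hτ : 0 < τ) (h : Admissible A B τ y₀ η) : x₀ τ y₀ η < 0 := by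
  have h1 := Real.log_pos h.one_lt
  have h2 : 0 < 1 / τ := by positivity
  rw [x₀]
  nlinarith

theorem I₀_nonneg (hy₀ : 0 ≤ y₀) : 0 ≤ I₀ A B τ y₀ η :=
  mul_nonneg (by positivity)
    (intervalIntegral.integral_nonneg (by linarith) fun _ _ => norm_nonneg _)

theorem Admissible.C_nonneg (h : Admissible A B τ y₀ η) : 0 ≤ C B τ y₀ η := by
  have h1 : 0 < 1 - ‖B‖ * η := by linarith [h.lt_norm]
  have h2 := h.eta_pos
  rw [C]
  positivity

/-- Contour integral estimate of the fundamental solution. -/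
theorem norm_fundamental_sub_causalExp_le {U : ℝ → Matrix (Fin n) (Fin n) ℂ} (hτ : 0 < τ)
    (hA : A.IsHermitian) (hαA : matrixAbscissa A < 0) (hαT : charAbscissa A B τ < 0)
    (hU : IsMildFundamental A B τ U) (h : Admissible A B τ y₀ η) {t : ℝ} (ht : τ ≤ t) :
    ‖U t - causalExp A t‖
      ≤ Real.exp (x₀ τ y₀ η * t) * (I₀ A B τ y₀ η + C B τ y₀ η / (t / τ)) := by
  have hη := h.eta_pos
  have hy₀ := h.y₀_pos
  have hbη : ‖B‖ * η < 1 := by linarith [h.lt_norm]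
  have hp : 0 < η * y₀ := by positivity
  have hT : charAbscissa A B τ < x₀ τ y₀ η := lt_x₀_of_lt_exp hτ hp h.lt_char
  have hR : matrixAbscissa A < x₀ τ y₀ η := lt_x₀_of_lt_exp hτ hp h.lt_matrix
  set c := 2 * (‖A‖ + ‖B‖) + 2 with hc
  have hxc : x₀ τ y₀ η ≤ c := (h.x₀_neg hτ).le.trans (by positivity)
  have hD : DelayBounded ‖B‖ τ (resolventDiff A B τ) := fun z hz => by
    obtain ⟨h1, h2, h3⟩ := resolventDiff_bound_im hA hz
    exact ⟨differentiableAt_resolventDiff h1 h2, h3⟩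
  have hDr : ∀ z : ℂ, x₀ τ y₀ η ≤ z.re → DifferentiableAt ℂ (resolventDiff A B τ) z := by
    intro z hz
    rw [matrixAbscissa_eq] at hR hαA
    exact differentiableAt_resolventDiff (isUnit_of_abscissa_lt hαT (hT.trans_le hz))
      (isUnit_of_abscissa_lt hαA (hR.trans_le hz))
  obtain ⟨hi, heq⟩ := fundamental_sub_causalExp_eq hτ hU hc.ge t
  have hb := norm_integral_line_le hD (norm_nonneg B) hτ hη hbη hy₀ hxc ht hDr hi
  rw [heq, norm_smul, Real.norm_of_nonneg (by positivity)]
  have hI : I₀ A B τ y₀ η = 1 / (2 * Real.pi)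
      * ∫ y in (-y₀)..y₀, ‖resolventDiff A B τ (x₀ τ y₀ η + y * Complex.I)‖ := rfl
  refine (mul_le_mul_of_nonneg_left hb (by positivity)).trans_eq ?_
  rw [hI, C]
  have h1 : 1 - ‖B‖ * η ≠ 0 := by linarith
  have h2 : t ≠ 0 := by linarith
  generalize (∫ y in (-y₀)..y₀, ‖resolventDiff A B τ (x₀ τ y₀ η + y * Complex.I)‖) = J
  generalize Real.sqrt (((τ * y₀) ^ 2)⁻¹ + 1) = Q
  field_simp

/-- The fundamental solution, cut off on `(-∞, 0)`, is a mild fundamental solution. -/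
theorem IsFundamentalSolution.isMildFundamental {Ψ : ℝ → Matrix (Fin n) (Fin n) ℂ} (hτ : 0 < τ)
    (hΨ : IsFundamentalSolution A B τ Ψ) : IsMildFundamental A B τ ((Ici 0).indicator Ψ) := by
  have h := (IsSolution.isMildSolution hτ (by simp) hΨ).1
  simp only [map_zero, indicator_zero] at h
  exact h

theorem IsFundamentalSolution.indicator_eq {Ψ : ℝ → Matrix (Fin n) (Fin n) ℂ}
    (hΨ : IsFundamentalSolution A B τ Ψ) {t : ℝ} (ht : -τ ≤ t) :
    (Ici 0).indicator Ψ t = Ψ t := by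
  rcases lt_or_ge t 0 with h | h
  · rw [indicator_of_notMem (by simpa using h), hΨ.history t ⟨ht, h⟩]
  · exact indicator_of_mem (mem_Ici.2 h) _

/-- Variation of constants acts through operators on the state space, so the matrix solution is
transported along the algebra isomorphism. -/
theorem IsMildFundamental.toEuclideanCLM {U : ℝ → Matrix (Fin n) (Fin n) ℂ}
    (hU : IsMildFundamental A B τ U) :
    IsMildFundamental (Matrix.toEuclideanCLM (𝕜 := ℂ) A) (Matrix.toEuclideanCLM (𝕜 := ℂ) B) τ
      fun t => Matrix.toEuclideanCLM (𝕜 := ℂ) (U t) := by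
  set L : Matrix (Fin n) (Fin n) ℂ →L[ℂ]
      (EuclideanSpace ℂ (Fin n) →L[ℂ] EuclideanSpace ℂ (Fin n)) :=
    LinearMap.toContinuousLinearMap
      (Matrix.toEuclideanCLM (n := Fin n) (𝕜 := ℂ)).toAlgEquiv.toLinearMap with hL
  have hLa : ∀ M, Matrix.toEuclideanCLM (𝕜 := ℂ) M = L M := fun M => rfl
  have hmul : ∀ M N, L (M * N) = L M * L N := fun M N =>
    map_mul (Matrix.toEuclideanCLM (n := Fin n) (𝕜 := ℂ)) M N
  refine ⟨fun t ht => by rw [hU.causal t ht, map_zero], ?_, fun t ht => ?_⟩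
  · exact L.continuous.comp_continuousOn hU.continuousOn
  · simp only [hLa]
    rw [L.intervalIntegral_comp_comm (hU.intervalIntegrable _ _),
      L.intervalIntegral_comp_comm (hU.intervalIntegrable _ _), hU.eq t ht]
    simp only [ContinuousLinearMap.mul_apply', Pi.zero_apply, intervalIntegral.integral_zero,
      add_zero, map_add, hmul]
    congr 2
    exact map_one (Matrix.toEuclideanCLM (n := Fin n) (𝕜 := ℂ))

end Fundamental

/-! ### The estimate (1) by the history. -/

section History

variable {n : ℕ} {A B : Matrix (Fin n) (Fin n) ℂ} {τ : ℝ}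

theorem historyIntegral_nonneg (hτ : 0 ≤ τ) (φ : ℝ → EuclideanSpace ℂ (Fin n)) :
    0 ≤ historyIntegral B τ φ :=
  intervalIntegral.integral_nonneg hτ fun _ _ => norm_nonneg _

theorem norm_le_historyBound {Ψ : ℝ → Matrix (Fin n) (Fin n) ℂ}
    {φ : ℝ → EuclideanSpace ℂ (Fin n)} {u₀ : EuclideanSpace ℂ (Fin n)}
    {u : ℝ → EuclideanSpace ℂ (Fin n)} (hτ : 0 < τ) (hΨ : IsFundamentalSolution A B τ Ψ)
    (hφ : IntegrableOn (fun s => Matrix.toEuclideanCLM (𝕜 := ℂ) B (φ s)) (Ico (-τ) 0) volume)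
    (hu : IsVectorSolution A B τ φ u₀ u) {t : ℝ} (ht : 0 ≤ t) :
    ‖u t‖ ≤ historyBound B τ Ψ φ u₀ t := by
  have hU := hΨ.isMildFundamental hτ
  obtain ⟨hx, hf⟩ := IsSolution.isMildSolution hτ hφ hu
  set f := (Ico 0 τ).indicator fun s => Matrix.toEuclideanCLM (𝕜 := ℂ) B (φ (s - τ)) with hfdef
  have hrep := IsMildSolution.eq_fundamental_add hτ.le hU.toEuclideanCLM hf
    (fun ν hν => indicator_of_notMem (by simp [hν]) _) hx t
  rw [indicator_of_mem (mem_Ici.2 ht)] at hrep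
  have hbdd : BddAbove ((fun ν : ℝ => ‖Ψ (t - ν)‖) '' Ico 0 τ) := by
    refine ⟨‖(1 : Matrix (Fin n) (Fin n) ℂ)‖ * Real.exp ((‖A‖ + ‖B‖) * t), ?_⟩
    rintro _ ⟨ν, hν, rfl⟩
    simp only
    rw [← hΨ.indicator_eq (by linarith [hν.2])]
    rcases lt_or_ge (t - ν) 0 with h | h
    · rw [hU.causal _ h, norm_zero]
      positivity
    · refine (hU.norm_le hτ.le le_rfl _ h).trans ?_
      gcongr
      linarith [hν.1]
  set S := sSup ((fun ν : ℝ => ‖Ψ (t - ν)‖) '' Ico 0 τ) with hS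
  have hint : ‖∫ ν, Matrix.toEuclideanCLM (𝕜 := ℂ) ((Ici 0).indicator Ψ (t - ν)) (f ν)‖
      ≤ ∫ ν, S * ‖f ν‖ := by
    refine norm_integral_le_of_norm_le (hf.norm.const_mul S) (.of_forall fun ν => ?_)
    by_cases hν : ν ∈ Ico 0 τ
    · refine (norm_toEuclideanCLM_apply_le _ _).trans ?_
      gcongr
      rw [hΨ.indicator_eq (by linarith [hν.2])]
      exact le_csSup hbdd ⟨ν, hν, rfl⟩
    · simp [hfdef, indicator_of_notMem hν]
  have hH : ∫ ν, ‖f ν‖ = historyIntegral B τ φ := by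
    rw [historyIntegral, intervalIntegral.integral_of_le hτ.le, ← integral_Ico_eq_integral_Ioc,
      ← integral_indicator measurableSet_Ico]
    congr 1
    ext ν
    exact norm_indicator_eq_indicator_norm _ _
  rw [integral_const_mul, hH] at hint
  rw [hrep, historyBound]
  refine (norm_add_le _ _).trans (add_le_add ?_ hint)
  rw [hΨ.indicator_eq (by linarith)]
  exact norm_toEuclideanCLM_apply_le _ _

end History

/-! ### The piecewise bound on a window of length `τ`. -/

section SupExp

variable {n : ℕ} {A B : Matrix (Fin n) (Fin n) ℂ} {τ y₀ η : ℝ}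

theorem supExp_nonneg (A : Matrix (Fin n) (Fin n) ℂ) (S : Set ℝ) : 0 ≤ supExp A S :=
  Real.sSup_nonneg (by rintro _ ⟨s, -, rfl⟩; exact norm_nonneg _)

/-- By continuity a supremum over an open interval also controls the endpoints, which the windows in
`k₂` omit. -/
theorem norm_exp_le_supExp (A : Matrix (Fin n) (Fin n) ℂ) {S : Set ℝ} (hS : Bornology.IsBounded S)
    {s : ℝ} (hs : s ∈ closure S) :
    ‖NormedSpace.exp ((s : ℂ) • A)‖ ≤ supExp A S := by
  have hc : Continuous fun s : ℝ => ‖NormedSpace.exp ((s : ℂ) • A)‖ :=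
    (continuous_exp_ofReal_smul A).norm
  have hb : BddAbove ((fun s : ℝ => ‖NormedSpace.exp ((s : ℂ) • A)‖) '' S) :=
    (hS.isCompact_closure.image hc).bddAbove.mono (image_mono subset_closure)
  exact closure_minimal (fun r hr => le_csSup hb ⟨r, hr, rfl⟩)
    (isClosed_le hc continuous_const) hs

theorem norm_fundamental_le_k₂ {U : ℝ → Matrix (Fin n) (Fin n) ℂ} (hτ : 0 < τ)
    (hA : A.IsHermitian) (hαA : matrixAbscissa A < 0) (hαT : charAbscissa A B τ < 0)
    (hU : IsMildFundamental A B τ U) (h : Admissible A B τ y₀ η) {s t : ℝ}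
    (hst : t - τ < s) (hs : s ≤ t) : ‖U s‖ ≤ k₂ A B τ y₀ η t := by
  have hI : 0 ≤ I₀ A B τ y₀ η := I₀_nonneg h.y₀_pos.le
  have hC := h.C_nonneg
  have hx := h.x₀_neg hτ
  have hsmall : ∀ S : Set ℝ, Bornology.IsBounded S → 0 ≤ s → s ≤ τ → s ∈ closure S →
      ‖U s‖ ≤ supExp A S := by
    intro S hS h0 h1 hmem
    rw [hU.eq_causalExp h1, causalExp_of_nonneg A h0]
    exact norm_exp_le_supExp A hS hmem
  -- Both `e^{x₀ s}` and `τ / s` decrease in `s`, so the contour bound at `s` may be replaced by its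
  -- value at any earlier time `r ≥ τ`.
  have hlarge : ∀ S : Set ℝ, ∀ r : ℝ, Bornology.IsBounded S → τ ≤ r → r ≤ s → s ∈ closure S →
      ‖U s‖ ≤ supExp A S + Real.exp (x₀ τ y₀ η * r) * (I₀ A B τ y₀ η + C B τ y₀ η / (r / τ)) := by
    intro S r hS hr hrs hmem
    have h0 : 0 ≤ s := by linarith
    have hr0 : 0 < r := by linarith
    have h1 := norm_fundamental_sub_causalExp_le hτ hA hαA hαT hU h (hr.trans hrs)
    rw [causalExp_of_nonneg A h0] at h1
    have h2 := norm_le_norm_add_norm_sub' (U s) (NormedSpace.exp ((s : ℂ) • A))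
    refine h2.trans (add_le_add (norm_exp_le_supExp A hS hmem) (h1.trans ?_))
    have h3 : Real.exp (x₀ τ y₀ η * s) ≤ Real.exp (x₀ τ y₀ η * r) :=
      Real.exp_le_exp.2 (mul_le_mul_of_nonpos_left hrs hx.le)
    gcongr
  rw [k₂]
  split_ifs with h1 h2
  · rcases lt_or_ge s 0 with h0 | h0
    · rw [hU.causal s h0, norm_zero]
      exact supExp_nonneg _ _
    · exact hsmall _ (Metric.isBounded_Icc _ _) h0 (by linarith) (subset_closure ⟨h0, hs⟩)
  · have hE : 0 ≤ Real.exp (x₀ τ y₀ η * τ) * (I₀ A B τ y₀ η + C B τ y₀ η) := by positivity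
    have hs1 := supExp_nonneg A (Ioo (t - τ) τ)
    have hs2 := supExp_nonneg A (Ioo τ t)
    rcases le_or_gt s τ with h3 | h3
    · have := hsmall (Ioo (t - τ) τ) (Metric.isBounded_Ioo _ _) (by linarith) h3
        (by rw [closure_Ioo (by linarith)]; exact ⟨hst.le, h3⟩)
      linarith
    -- Here `τ < s ≤ t`, so the interval is nonempty; at `t = τ`, where it is empty, this branch
    -- does not occur.
    · have := hlarge (Ioo τ t) τ (Metric.isBounded_Ioo _ _) le_rfl h3.le
        (by rw [closure_Ioo (by linarith)]; exact ⟨h3.le, hs⟩)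
      rw [div_self hτ.ne', div_one] at this
      linarith
  · exact hlarge _ _ (Metric.isBounded_Ioo _ _) (by linarith) hst.le
      (by rw [closure_Ioo (by linarith)]; exact ⟨hst.le, hs⟩)

end SupExp

end DDE

end

theorem mainTheorem5 (n : ℕ) (A B : Matrix (Fin n) (Fin n) ℂ) (τ : ℝ)
    (hτ : 0 < τ) (hA : A.IsHermitian)
    (hαA : DDE.matrixAbscissa A < 0) (hαT : DDE.charAbscissa A B τ < 0)
    (Ψ : ℝ → Matrix (Fin n) (Fin n) ℂ) (hΨ : DDE.IsFundamentalSolution A B τ Ψ)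
    (φ : ℝ → EuclideanSpace ℂ (Fin n)) (u₀ : EuclideanSpace ℂ (Fin n))
    (hφ : IntegrableOn (fun s => Matrix.toEuclideanCLM (𝕜 := ℂ) B (φ s)) (Ico (-τ) 0) volume)
    (u : ℝ → EuclideanSpace ℂ (Fin n)) (hu : DDE.IsVectorSolution A B τ φ u₀ u) :
    (∀ t : ℝ, 0 ≤ t → ‖u t‖ ≤ DDE.historyBound B τ Ψ φ u₀ t) ∧
    ∀ y₀ η : ℝ, DDE.Admissible A B τ y₀ η →
      ∀ k₁ : ℝ → ℝ, (∀ t : ℝ, 0 ≤ t → ‖Ψ t‖ ≤ k₁ t) →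
        ∀ t : ℝ, 0 ≤ t →
          DDE.historyBound B τ Ψ φ u₀ t ≤
            k₁ t * ‖u₀‖ + DDE.k₂ A B τ y₀ η t * DDE.historyIntegral B τ φ := by
  refine ⟨fun t ht => DDE.norm_le_historyBound hτ hΨ hφ hu ht, fun y₀ η h k₁ hk₁ t ht => ?_⟩
  have hH := DDE.historyIntegral_nonneg (B := B) hτ.le φ
  have hk₁t := hk₁ t ht
  rw [DDE.historyBound]
  gcongr
  refine csSup_le ((nonempty_Ico.2 hτ).image _) ?_
  rintro _ ⟨ν, hν, rfl⟩
  simp only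
  -- As `ν < τ` and `t ≥ 0`, the argument stays above `-τ`, where `Ψ` agrees with its cut-off.
  rw [← hΨ.indicator_eq (by linarith [hν.2])]
  exact DDE.norm_fundamental_le_k₂ hτ hA hαA hαT (hΨ.isMildFundamental hτ) h
    (by linarith [hν.2]) (by linarith [hν.1])
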